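/- \textbf{Conventions.} $X,Y,Z$ are the Pauli matrices. For a set $\mathcal S$ of Hermitian matrices on $k$ qubits, an $\mathcal S$-Hamiltonian on $m$ qubits is a sum of terms, each of which is either an element of $\mathcal S$ applied to some $k$ distinct qubits with an arbitrary real weight, or a real multiple of the identity. For a Hamiltonian $H'$ let $P_{\le\Delta(H')}$ be the orthogonal projector onto the span of the eigenvectors of $H'$ with eigenvalue at most $\Delta$, and $H'_{\le\Delta}=H'P_{\le\Delta(H')}$. $\|\cdot\|$ is the operator norm. A \emph{local encoding} of $n$ qubits into $m$ qubits is a map $\mathcal E(M)=V(M\otimes P+\bar M\otimes Q)V^\dagger$, where the $m$ qubits are partitioned into $n$ groups with Hilbert spaces $\mathcal H'_1,\dots,\mathcal H'_n$, $V=\bigotimes_j V_j$ for isometries $V_j:\mathbb C^2\otimes E_j\to\mathcal H'_j$ with finite-dimensional ancillas $E_j$, and $P,Q$ are mutually orthogonal projectors on $\bigotimes_j E_j$, not both zero, such that for every $j$ there are mutually orthogonal projectors $P_{E_j},Q_{E_j}$ on $E_j$ with $(P_{E_j}\otimes 1)P=P$ and $(Q_{E_j}\otimes 1)Q=Q$.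 A Hamiltonian $H'$ on $m$ qubits is a \emph{$(\Delta,\eta,\epsilon)$-simulation} of a Hamiltonian $H$ on $n$ qubits, with the local encoding $\mathcal E$, if there is an isometry $\widetilde V$ such that $\widetilde{\mathcal E}(M)=\widetilde V(M\otimes P+\bar M\otimes Q)\widetilde V^\dagger$ satisfies $\widetilde{\mathcal E}(1)=P_{\le\Delta(H')}$, $\|\widetilde V-V\|\le\eta$ and $\|H'_{\le\Delta}-\widetilde{\mathcal E}(H)\|\le\epsilon$. A family $\mathcal F'$ of Hamiltonians \emph{can simulate} a family $\mathcal F$ if for every $H\in\mathcal F$ there is $\Delta_0>0$ such that for all $\eta,\epsilon>0$ and all $\Delta\ge\Delta_0$ some $H'\in\mathcal F'$ is a $(\Delta,\eta,\epsilon)$-simulation of $H$ (with some local encoding). \textbf{Theorem.} Let $\mathcal F$ be the family of qubit Hamiltonians, on any number of qubits, of the form $$H=\sum_{i>j}\ \sum_{A\in\{XX,XZ,ZX,ZZ\}}\alpha^{A}_{ij}A_{ij}+\sum_k(\beta_kX_k+\gamma_kZ_k)+c\,1$$ with real coefficients $\alpha^A_{ij},\beta_k,\gamma_k,c$, where $A_{ij}$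 runs over $X_iX_j$, $X_iZ_j$, $Z_iX_j$, $Z_iZ_j$. Then the $\{XX+YY+ZZ\}$-Hamiltonians can simulate $\mathcal F$, and the $\{XX+YY\}$-Hamiltonians can simulate $\mathcal F$. Moreover, let $h$ be $XX+YY+ZZ$ or $XX+YY$. The ground space of the 4-qubit Hamiltonian $\sum_{1\le i<j\le4}h_{ij}$ is 2-dimensional, and there is an isometry $W:\mathbb C^2\to(\mathbb C^2)^{\otimes4}$ onto it such that, for every $n$, every $H\in\mathcal F$ on $n$ qubits can be simulated as above, for all $\eta,\epsilon>0$ and all $\Delta\ge\Delta_0(H)$, by an $\{h\}$-Hamiltonian on $4n$ qubits with the local encoding $\mathcal E(M)=W^{\otimes n}M(W^{\otimes n})^\dagger$; that is, each logical qubit is encoded by $W$ in its own block of four qubits. -/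

import Mathlib

namespace QubitSim

open scoped Kronecker
open scoped Matrix.Norms.L2Operator

/-! ### Operators on qubits -/

/-- Operators on `n` qubits, as matrices in the computational basis `Fin n → Fin 2`. -/
abbrev QOp (n : ℕ) : Type := Matrix (Fin n → Fin 2) (Fin n → Fin 2) ℂ

/-- The operator `A_j ⊗ 𝟙` on a tensor product `⨂ i, ℂ^(κ i)`: it acts as `A` on the factor `j` and
as the identity on all the others. -/
def onSite {ι : Type} [Fintype ι] [DecidableEq ι] {κ : ι → Type} [∀ i, DecidableEq (κ i)]
    (j : ι) (A : Matrix (κ j) (κ j) ℂ) : Matrix (∀ i, κ i) (∀ i, κ i) ℂ :=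
  Matrix.of fun s t => if ∀ i, i ≠ j → s i = t i then A (s j) (t j) else 0

/-- The one-qubit operator `A` acting on qubit `j` of `n` qubits. -/
def onQubit {n : ℕ} (j : Fin n) (A : Matrix (Fin 2) (Fin 2) ℂ) : QOp n :=
  onSite (κ := fun _ : Fin n => Fin 2) j A

/-- The `k`-qubit operator `h` acting on the qubits `f 0, …, f (k - 1)` of `m` qubits (for an
injective `f`) and as the identity on the others. -/
def placed {k m : ℕ} (f : Fin k → Fin m) (h : QOp k) : QOp m :=
  Matrix.of fun s t => if ∀ a, (∀ i, f i ≠ a) → s a = t a then h (s ∘ f) (t ∘ f) else 0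

def pauliX : Matrix (Fin 2) (Fin 2) ℂ := !![0, 1; 1, 0]

def pauliY : Matrix (Fin 2) (Fin 2) ℂ := !![0, -Complex.I; Complex.I, 0]

def pauliZ : Matrix (Fin 2) (Fin 2) ℂ := !![1, 0; 0, -1]

/-- The Heisenberg interaction `XX + YY + ZZ`. -/
def heisenberg : QOp 2 :=
  onQubit 0 pauliX * onQubit 1 pauliX + onQubit 0 pauliY * onQubit 1 pauliY
    + onQubit 0 pauliZ * onQubit 1 pauliZ

/-- The XY interaction `XX + YY`. -/
def xyInteraction : QOp 2 :=
  onQubit 0 pauliX * onQubit 1 pauliX + onQubit 0 pauliY * onQubit 1 pauliY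

/-! ### Families of Hamiltonians -/

/-- A family of qubit Hamiltonians: for every `n`, a set of Hamiltonians on `n` qubits. -/
abbrev Family : Type := ∀ n : ℕ, Set (QOp n)

/-- For a set `S` of `k`-qubit interactions, the family of `S`-Hamiltonians: sums of interactions
from `S`, applied to arbitrary distinct qubits with arbitrary real weights, and of a real multiple
of the identity. -/
def interactionFamily {k : ℕ} (S : Set (QOp k)) : Family := fun m =>
  (Submodule.span ℝ
    ({(1 : QOp m)} ∪ {T | ∃ h ∈ S, ∃ f : Fin k → Fin m, Function.Injective f ∧ T = placed f h}) :
    Submodule ℝ (QOp m))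

/-- The two Pauli matrices `X` and `Z`. -/
def pauliXZ : Fin 2 → Matrix (Fin 2) (Fin 2) ℂ := ![pauliX, pauliZ]

/-- The qubit Hamiltonians `∑_{i > j} ∑_A α_{ij}^A A_{ij} + ∑_k (β_k X_k + γ_k Z_k) + c 𝟙`, where
`A_{ij}` runs over `X_i X_j`, `X_i Z_j`, `Z_i X_j`, `Z_i Z_j`, and all coefficients are real. -/
def xzFamily : Family := fun n =>
  {H | ∃ (α : Fin n → Fin n → Fin 2 → Fin 2 → ℝ) (β γ : Fin n → ℝ) (c : ℝ),
    H = (∑ i, ∑ j ∈ Finset.Iio i, ∑ p, ∑ q,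
          α i j p q • (onQubit i (pauliXZ p) * onQubit j (pauliXZ q)))
        + ∑ k, (β k • onQubit k pauliX + γ k • onQubit k pauliZ)
        + c • (1 : QOp n)}

/-! ### Low-energy spaces -/

/-- The span of the eigenvectors of `H` with eigenvalue at most `Δ`. -/
noncomputable def lowEnergySpace {n : ℕ} (H : QOp n) (Δ : ℝ) :
    Submodule ℂ (EuclideanSpace ℂ (Fin n → Fin 2)) :=
  ⨆ (lam : ℝ) (_ : lam ≤ Δ), Module.End.eigenspace (Matrix.toEuclideanLin H) (lam : ℂ)

/-- The matrix of the orthogonal projector onto the span of the eigenvectors of `H` with eigenvalue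
at most `Δ`. -/
noncomputable def lowEnergyProj {n : ℕ} (H : QOp n) (Δ : ℝ) : QOp n :=
  Matrix.toEuclideanLin.symm ((lowEnergySpace H Δ).starProjection : _ →ₗ[ℂ] _)

/-- The eigenspace of `H` for its least eigenvalue. -/
noncomputable def groundSpace {n : ℕ} (H : QOp n) :
    Submodule ℂ (EuclideanSpace ℂ (Fin n → Fin 2)) :=
  Module.End.eigenspace (Matrix.toEuclideanLin H)
    ((sInf {lam : ℝ | Module.End.HasEigenvalue (Matrix.toEuclideanLin H) (lam : ℂ)} : ℝ) : ℂ)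

/-! ### Encodings and simulations -/

/-- The map `M ↦ V (M ⊗ P + M̄ ⊗ Q) V†`. -/
noncomputable def encode {a e b : Type} [Fintype a] [Fintype e]
    (V : Matrix b (a × e) ℂ) (P Q : Matrix e e ℂ) (M : Matrix a a ℂ) : Matrix b b ℂ :=
  V * (M ⊗ₖ P + (M.map (starRingEnd ℂ)) ⊗ₖ Q) * V.conjTranspose

/-- A local encoding `M ↦ V (M ⊗ P + M̄ ⊗ Q) V†` of `n` qubits into `m` qubits. The `m` qubits are
partitioned into `n` groups; `V` is the tensor product of isometries `V_j : ℂ² ⊗ E_j → ℋ'_j`, where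
`ℋ'_j` is the space of the `j`-th group and `E_j` an ancilla; `P` and `Q` are orthogonal projectors
on `⨂ j, E_j` which are not both zero, are mutually orthogonal, and can be distinguished locally by
projectors on each single `E_j`. -/
structure LocalEncoding (n m : ℕ) where
  group : Fin m → Fin n
  ancDim : Fin n → ℕ
  iso : ∀ j, Matrix ({a // group a = j} → Fin 2) (Fin 2 × Fin (ancDim j)) ℂ
  P : Matrix (∀ j, Fin (ancDim j)) (∀ j, Fin (ancDim j)) ℂ
  Q : Matrix (∀ j, Fin (ancDim j)) (∀ j, Fin (ancDim j)) ℂ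
  iso_isometry : ∀ j, (iso j).conjTranspose * iso j = 1
  proj_P : IsStarProjection P
  proj_Q : IsStarProjection Q
  orthogonal : P * Q = 0
  nontrivial : P ≠ 0 ∨ Q ≠ 0
  distinguishable : ∀ j, ∃ PE QE : Matrix (Fin (ancDim j)) (Fin (ancDim j)) ℂ,
    IsStarProjection PE ∧ IsStarProjection QE ∧ PE * QE = 0 ∧
    onSite (κ := fun i => Fin (ancDim i)) j PE * P = P ∧
    onSite (κ := fun i => Fin (ancDim i)) j QE * Q = Q

/-- The local isometry `V = ⨂ j, V_j`. -/
def LocalEncoding.V {n m : ℕ} (E : LocalEncoding n m) :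
    Matrix (Fin m → Fin 2) ((Fin n → Fin 2) × (∀ j, Fin (E.ancDim j))) ℂ :=
  Matrix.of fun s x => ∏ j, E.iso j (fun a => s a.1) (x.1 j, x.2 j)

/-- `H'` is a `(Δ, η, ε)`-simulation of `H` with the local encoding `E`: there is an encoding
`M ↦ Ṽ (M ⊗ P + M̄ ⊗ Q) Ṽ†` onto the space of energies at most `Δ` of `H'`, with an isometry `Ṽ`
within `η` of `V`, which maps `H` to within `ε` of the low-energy part of `H'`. Norms are operator
norms. -/
def SimulatesVia {n m : ℕ} (E : LocalEncoding n m) (H' : QOp m) (H : QOp n) (Δ η ε : ℝ) : Prop :=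
  ∃ V' : Matrix (Fin m → Fin 2) ((Fin n → Fin 2) × (∀ j, Fin (E.ancDim j))) ℂ,
    V'.conjTranspose * V' = 1 ∧
    encode V' E.P E.Q 1 = lowEnergyProj H' Δ ∧
    ‖V' - E.V‖ ≤ η ∧
    ‖H' * lowEnergyProj H' Δ - encode V' E.P E.Q H‖ ≤ ε

/-- `H'` is a `(Δ, η, ε)`-simulation of `H`. -/
def IsSimulation {n m : ℕ} (H' : QOp m) (H : QOp n) (Δ η ε : ℝ) : Prop :=
  ∃ E : LocalEncoding n m, SimulatesVia E H' H Δ η ε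

/-- The family `F'` can simulate the family `F`: every `H ∈ F` is simulated by members of `F'` to
any accuracy, below any energy cut-off that is at least some `Δ₀` (which depends on `H` only). -/
def CanSimulate (F' F : Family) : Prop :=
  ∀ (n : ℕ) (H : QOp n), H ∈ F n → ∃ Δ₀ : ℝ, 0 < Δ₀ ∧
    ∀ Δ η ε : ℝ, Δ₀ ≤ Δ → 0 < η → 0 < ε →
      ∃ (m : ℕ) (H' : QOp m), H' ∈ F' m ∧ IsSimulation H' H Δ η ε

/-! ### One logical qubit in four physical qubits -/

/-- The sum of the interaction `h` over all pairs of 4 qubits. -/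
def completeGraph4 (h : QOp 2) : QOp 4 :=
  ∑ i : Fin 4, ∑ j ∈ Finset.Ioi i, placed ![i, j] h

/-- The `j`-th block of four among `n * 4` qubits. -/
def blockEquiv (n : ℕ) (j : Fin n) :
    Fin 4 ≃ {a : Fin (n * 4) // (finProdFinEquiv.symm a).1 = j} where
  toFun k := ⟨finProdFinEquiv (j, k), by simp⟩
  invFun a := (finProdFinEquiv.symm a.1).2
  left_inv k := by simp
  right_inv a := by
    obtain ⟨a, rfl⟩ := a
    exact Subtype.ext (finProdFinEquiv.apply_symm_apply a)

/-- The local encoding `M ↦ V M V†` with `V = W ⊗ ⋯ ⊗ W`, for an isometry `W` of one qubit into four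
qubits: qubit `j` goes into the `j`-th block of four. (There is no ancilla: `E_j = ℂ`, `P = 𝟙`,
`Q = 0`.) -/
def blockEncoding (W : Matrix (Fin 4 → Fin 2) (Fin 2) ℂ) (hW : W.conjTranspose * W = 1) (n : ℕ) :
    LocalEncoding n (n * 4) where
  group a := (finProdFinEquiv.symm a).1
  ancDim _ := 1
  iso j := Matrix.of fun s x => W (s ∘ blockEquiv n j) x.1
  P := 1
  Q := 0
  iso_isometry j := by
    ext x y
    have h := congrFun (congrFun hW x.1) y.1
    rw [Matrix.mul_apply] at h ⊢
    have h1 : (1 : Matrix (Fin 2 × Fin 1) (Fin 2 × Fin 1) ℂ) x y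
        = (1 : Matrix (Fin 2) (Fin 2) ℂ) x.1 y.1 := by
      simp [Matrix.one_apply, Prod.ext_iff, Subsingleton.elim x.2 y.2]
    rw [h1, ← h]
    exact Fintype.sum_equiv ((blockEquiv n j).symm.arrowCongr (Equiv.refl (Fin 2))) _ _
      (fun s => rfl)
  proj_P := IsStarProjection.one _
  proj_Q := IsStarProjection.zero _
  orthogonal := by simp
  nontrivial := Or.inl one_ne_zero
  distinguishable j := by
    refine ⟨1, 0, IsStarProjection.one _, IsStarProjection.zero _, by simp, ?_, by simp⟩
    rw [Matrix.mul_one]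
    ext s t
    simp [onSite, Matrix.one_apply, Subsingleton.elim s t]

end QubitSim

open QubitSim

/-!
The singlets of four qubits form a two-dimensional space, which encodes one logical qubit, and every
low-energy effect of the exchange interactions on it can be read off from rotation invariance.

Both interactions have the form `∑ c ∈ D, σ_c ⊗ σ_c` (`exchange`), with `D = {X, Y, Z}` or
`D = {X, Y}`. On the complete graph of four qubits it is, up to a constant, half the sum of the
squares of the spin components in `D` (`blockHam`, `completeGraph4_exchange`). States without spin in
two directions are singlets, so the ground space is the singlet space for either choice
(`groundSpace_completeGraph4`). A single Pauli matrix `σ_c`, `c ∈ D`, maps singlets to an eigenspace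
of `blockHam` (`blockHam_mul_pauli`), because double commutators with the spin components multiply
`σ_c` by constants.

There are three ways to split four qubits into two pairs. A computational basis state with two
zeros and two ones singles out one of them, and compressing the corresponding projectors to the
singlet space gives three positive operators `pairProj r` which add up to `1` and span, over the
reals, `1`, `X` and `Z`. Two compressions produce them. Within a block, the exchange interaction of
a pair gives a multiple of `2 * pairProj r - 1` (`compression_pair`). Between blocks, let
`staggered c r` be the sum of `σ_c` over the block with signs `±1` according to the pairing `r`; its
own compression vanishes, and products of two of them compress to `16 * pairProj r` if both the
directions and the pairings agree, and to `0` otherwise (`compression_staggered_mul_staggered`). By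
rotation invariance it suffices to see this for the diagonal matrices `Z`.

Take a strong `blockHam` on each block, links `w r q * ∑ c, staggered c r ⊗ staggered c q` of
intermediate strength between blocks, and weak interactions within blocks. In second-order
perturbation theory (`exists_perturbation`) the links contribute
`- const * ∑ (w r q)^2 * pairProj r ⊗ pairProj q` for every pair of blocks; contributions of two
different pairs vanish, since they leave a block with a single `staggered` operator. The sign
restriction is harmless: adding the same constant to all nine coefficients only shifts the energy,
as the `pairProj r` add up to `1` (`exists_link_weights`). So every `X`-`Z` Hamiltonian arises.

The perturbation theory is rigorous through an approximate intertwiner `T` between the target and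
the simulator that is a polynomial in the small parameter. Projecting `T` to the low-energy space
and taking the isometric part of its polar decomposition gives the isometry required of a simulation
(`exists_isometry_of_approx_intertwiner`).
-/

set_option linter.unusedSectionVars false

namespace QubitSim

open Matrix
open scoped ComplexOrder
open scoped Kronecker
open scoped Matrix.Norms.L2Operator

/-! ### Matrices as operators on Euclidean spaces -/

section Euclidean

variable {a b c : Type*} [Fintype a] [Fintype b] [Fintype c]
  [DecidableEq a] [DecidableEq b] [DecidableEq c]

lemma toEuclideanLin_mul_apply (A : Matrix a b ℂ) (B : Matrix b c ℂ) (x : EuclideanSpace ℂ c) :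
    toEuclideanLin (A * B) x = toEuclideanLin A (toEuclideanLin B x) := by
  simp [toLpLin_apply, Matrix.mulVec_mulVec]

lemma toEuclideanLin_one_apply (x : EuclideanSpace ℂ a) :
    toEuclideanLin (1 : Matrix a a ℂ) x = x := by
  simp

lemma norm_toEuclideanLin_le (A : Matrix a b ℂ) (x : EuclideanSpace ℂ b) :
    ‖toEuclideanLin A x‖ ≤ ‖A‖ * ‖x‖ := by
  rw [toLpLin_apply]; exact l2_opNorm_mulVec A x

lemma l2_opNorm_mul_le_of_le {A : Matrix a b ℂ} {B : Matrix b c ℂ} {C D : ℝ} (hA : ‖A‖ ≤ C)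
    (hB : ‖B‖ ≤ D) : ‖A * B‖ ≤ C * D :=
  (l2_opNorm_mul A B).trans (mul_le_mul hA hB (norm_nonneg B) ((norm_nonneg A).trans hA))

lemma l2_opNorm_le_of_forall {A : Matrix a b ℂ} {C : ℝ} (hC : 0 ≤ C)
    (h : ∀ x, ‖toEuclideanLin A x‖ ≤ C * ‖x‖) : ‖A‖ ≤ C := by
  rw [l2_opNorm_def]
  exact ContinuousLinearMap.opNorm_le_bound _ hC h

lemma inner_toEuclideanLin_right (A : Matrix a b ℂ) (x : EuclideanSpace ℂ a)
    (y : EuclideanSpace ℂ b) :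
    inner ℂ x (toEuclideanLin A y) = inner ℂ (toEuclideanLin Aᴴ x) y := by
  rw [toEuclideanLin_conjTranspose_eq_adjoint, LinearMap.adjoint_inner_left]

/-- The quadratic form of `BᴴB` is the squared length of `Bx`. -/
lemma re_inner_conjTranspose_mul_self (B : Matrix a b ℂ) (x : EuclideanSpace ℂ b) :
    (inner ℂ x (toEuclideanLin (Bᴴ * B) x)).re = ‖toEuclideanLin B x‖ ^ 2 := by
  rw [toEuclideanLin_mul_apply, inner_toEuclideanLin_right, conjTranspose_conjTranspose]
  exact inner_self_eq_norm_sq (𝕜 := ℂ) _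

lemma abs_re_inner_toEuclideanLin_le (A : Matrix a a ℂ) (x : EuclideanSpace ℂ a) :
    |(inner ℂ x (toEuclideanLin A x)).re| ≤ ‖A‖ * ‖x‖ ^ 2 := by
  refine (Complex.abs_re_le_norm _).trans ((norm_inner_le_norm _ _).trans ?_)
  have := norm_toEuclideanLin_le A x
  nlinarith [norm_nonneg x]

lemma l2_opNorm_isometry_le_one [Nonempty b] {V : Matrix a b ℂ} (hV : Vᴴ * V = 1) : ‖V‖ ≤ 1 := by
  have h := l2_opNorm_conjTranspose_mul_self V
  rw [hV, CStarRing.norm_one] at h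
  nlinarith [norm_nonneg V]

/-- A positive definite matrix is bounded below by a positive multiple of the identity. -/
lemma exists_pos_forall_le_re_inner {B : Matrix a a ℂ} (hB : B.PosDef) :
    ∃ g : ℝ, 0 < g ∧ ∀ x : EuclideanSpace ℂ a,
      g * ‖x‖ ^ 2 ≤ (inner ℂ x (toEuclideanLin B x)).re := by
  obtain ⟨C, hC⟩ : ∃ C : Matrix a a ℂ, B = Cᴴ * C := by
    have := hB.posSemidef
    open scoped MatrixOrder in
    exact CStarAlgebra.nonneg_iff_eq_star_mul_self.mp this.nonneg
  have hdet : IsUnit C.det := by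
    have h := (Matrix.isUnit_iff_isUnit_det _).mp hB.isUnit
    rw [hC, det_mul] at h
    exact isUnit_of_mul_isUnit_right h
  refine ⟨(‖C⁻¹‖ ^ 2 + 1)⁻¹, by positivity, fun x => ?_⟩
  rw [hC, re_inner_conjTranspose_mul_self]
  have h1 : x = toEuclideanLin C⁻¹ (toEuclideanLin C x) := by
    rw [← toEuclideanLin_mul_apply, nonsing_inv_mul _ hdet, toEuclideanLin_one_apply]
  have h2 : ‖x‖ ≤ ‖C⁻¹‖ * ‖toEuclideanLin C x‖ := by
    conv_lhs => rw [h1]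
    exact norm_toEuclideanLin_le _ _
  rw [inv_mul_le_iff₀ (by positivity)]
  have h3 : ‖x‖ ^ 2 ≤ (‖C⁻¹‖ * ‖toEuclideanLin C x‖) ^ 2 := by gcongr
  nlinarith [sq_nonneg ‖toEuclideanLin C x‖]

/-- If `BᴴB` is close to `1`, then `B (BᴴB)^(-1/2)` is an isometry and `(BᴴB)^(-1/2)` is as close
to `1`. The inverse of the latter is returned as well. -/
lemma exists_polar [Nonempty a] (B : Matrix b a ℂ) {δ : ℝ} (hδ : δ ≤ 1 / 2)
    (hB : ‖Bᴴ * B - 1‖ ≤ δ) :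
    ∃ s r : Matrix a a ℂ, r * s = 1 ∧ s * r = 1 ∧ sᴴ = s ∧ (B * s)ᴴ * (B * s) = 1 ∧ ‖s - 1‖ ≤ δ := by
  set G := Bᴴ * B with hG
  have hsa : IsSelfAdjoint G := by
    rw [hG, isSelfAdjoint_iff, star_eq_conjTranspose, conjTranspose_mul, conjTranspose_conjTranspose]
  have hδ0 : 0 ≤ δ := (norm_nonneg _).trans hB
  have hspec : ∀ x ∈ spectrum ℝ G, |x - 1| ≤ δ := by
    intro x hx
    have h := norm_apply_le_norm_cfc (fun x : ℝ => x - 1) G hx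
    rw [cfc_sub (fun x : ℝ => x) (fun _ => 1) G, cfc_id' ℝ G, cfc_const_one ℝ G] at h
    exact (Real.norm_eq_abs _ ▸ h).trans hB
  have hpos : ∀ x ∈ spectrum ℝ G, 0 < x := fun x hx => by
    have := abs_le.mp (hspec x hx); linarith
  have hcont : ContinuousOn (fun x : ℝ => (√x)⁻¹) (spectrum ℝ G) :=
    (Real.continuous_sqrt.continuousOn).inv₀ fun x hx => (Real.sqrt_pos.mpr (hpos x hx)).ne'
  have hcont' : ContinuousOn (fun x : ℝ => √x) (spectrum ℝ G) := Real.continuous_sqrt.continuousOn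
  have hs : (cfc (fun x : ℝ => (√x)⁻¹) G)ᴴ = cfc (fun x : ℝ => (√x)⁻¹) G :=
    (cfc_predicate (R := ℝ) (fun x : ℝ => (√x)⁻¹) G : IsSelfAdjoint _)
  refine ⟨cfc (fun x : ℝ => (√x)⁻¹) G, cfc (fun x : ℝ => √x) G, ?_, ?_, hs, ?_, ?_⟩
  · rw [← cfc_mul _ _ G hcont' hcont, ← cfc_const_one ℝ G]
    exact cfc_congr fun x hx => mul_inv_cancel₀ (Real.sqrt_pos.mpr (hpos x hx)).ne'
  · rw [← cfc_mul _ _ G hcont hcont', ← cfc_const_one ℝ G]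
    exact cfc_congr fun x hx => inv_mul_cancel₀ (Real.sqrt_pos.mpr (hpos x hx)).ne'
  · have hc2 : ContinuousOn (fun x : ℝ => (√x)⁻¹ * x) (spectrum ℝ G) :=
      hcont.mul continuousOn_id
    have h1 : (B * cfc (fun x : ℝ => (√x)⁻¹) G)ᴴ * (B * cfc (fun x : ℝ => (√x)⁻¹) G)
        = cfc (fun x : ℝ => (√x)⁻¹) G * cfc (fun x : ℝ => x) G * cfc (fun x : ℝ => (√x)⁻¹) G := by
      rw [cfc_id' ℝ G, conjTranspose_mul, hs, hG]
      simp only [Matrix.mul_assoc]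
    rw [h1, ← cfc_mul _ (fun x : ℝ => x) G hcont continuousOn_id, ← cfc_mul _ _ G hc2 hcont,
      ← cfc_const_one ℝ G]
    refine cfc_congr fun x hx => ?_
    have hx0 := hpos x hx
    have h2 := (Real.sqrt_pos.mpr hx0).ne'
    have h3 := Real.mul_self_sqrt hx0.le
    change (√x)⁻¹ * x * (√x)⁻¹ = 1
    field_simp
    nlinarith
  · rw [← cfc_const_one ℝ G, ← cfc_sub _ _ G hcont continuousOn_const]
    refine norm_cfc_le hδ0 fun x hx => ?_
    have hx1 := abs_le.mp (hspec x hx)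
    have hx0 := hpos x hx
    have h3 := Real.mul_self_sqrt hx0.le
    have h4 : 0 < √x := Real.sqrt_pos.mpr hx0
    have h6 : 1 / 2 ≤ √x := by
      by_contra! h
      nlinarith
    rw [Real.norm_eq_abs]
    have h5 : (√x)⁻¹ - 1 = (1 - x) * (√x * (1 + √x))⁻¹ := by
      field_simp
      nlinarith
    rw [h5, abs_mul, abs_inv, abs_of_pos (show 0 < √x * (1 + √x) by positivity), abs_sub_comm]
    have h7 : (√x * (1 + √x))⁻¹ ≤ 1 := inv_le_one_of_one_le₀ (by nlinarith)
    calc |x - 1| * (√x * (1 + √x))⁻¹ ≤ |x - 1| * 1 := by gcongr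
      _ ≤ δ := by rw [mul_one]; exact hspec x hx

end Euclidean

lemma toEuclideanLin_real_smul {a b : Type*} [Fintype b] [DecidableEq b] (c : ℝ)
    (M : Matrix a b ℂ) (x : EuclideanSpace ℂ b) :
    toEuclideanLin (c • M) x = (c : ℂ) • toEuclideanLin M x := by
  have : c • M = (c : ℂ) • M := by ext i j; simp
  rw [this, map_smul, LinearMap.smul_apply]

lemma dotProduct_conjTranspose_mul_self_mulVec {a b : Type*} [Fintype a] [Fintype b]
    (B : Matrix a b ℂ) (x : b → ℂ) :
    star x ⬝ᵥ ((Bᴴ * B) *ᵥ x) = star (B *ᵥ x) ⬝ᵥ (B *ᵥ x) := by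
  rw [← Matrix.mulVec_mulVec, Matrix.dotProduct_mulVec, star_mulVec]

/-- A Gram sum is positive definite as soon as its factors have no common kernel. -/
lemma posDef_sum_conjTranspose_mul_self {ι a b : Type*} [Fintype a] [DecidableEq a] [Fintype b]
    [DecidableEq b] (s : Finset ι) (A : ι → Matrix b b ℂ) (V : Matrix b a ℂ)
    (h : ∀ x, (∀ i ∈ s, A i *ᵥ x = 0) → Vᴴ *ᵥ x = 0 → x = 0) :
    (∑ i ∈ s, (A i)ᴴ * A i + V * Vᴴ).PosDef := by
  have hps : (∑ i ∈ s, (A i)ᴴ * A i + V * Vᴴ).PosSemidef :=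
    (posSemidef_sum s fun i _ => posSemidef_conjTranspose_mul_self (A i)).add
      (posSemidef_self_mul_conjTranspose V)
  refine PosDef.of_dotProduct_mulVec_pos hps.isHermitian fun x hx => ?_
  refine lt_of_le_of_ne (hps.dotProduct_mulVec_nonneg x) fun h0 => hx ?_
  rw [Matrix.add_mulVec, Matrix.sum_mulVec, dotProduct_add, dotProduct_sum] at h0
  have hV : star x ⬝ᵥ ((V * Vᴴ) *ᵥ x) = star (Vᴴ *ᵥ x) ⬝ᵥ (Vᴴ *ᵥ x) := by
    have := dotProduct_conjTranspose_mul_self_mulVec Vᴴ x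
    rwa [conjTranspose_conjTranspose] at this
  have hs : ∀ i ∈ s, 0 ≤ star x ⬝ᵥ (((A i)ᴴ * A i) *ᵥ x) := fun i _ => by
    rw [dotProduct_conjTranspose_mul_self_mulVec]; exact dotProduct_star_self_nonneg _
  have hV0 : 0 ≤ star x ⬝ᵥ ((V * Vᴴ) *ᵥ x) := by
    rw [hV]; exact dotProduct_star_self_nonneg _
  rw [eq_comm, add_eq_zero_iff_of_nonneg (Finset.sum_nonneg hs) hV0,
    Finset.sum_eq_zero_iff_of_nonneg hs] at h0
  refine h x (fun i hi => ?_) ?_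
  · have := h0.1 i hi
    rw [dotProduct_conjTranspose_mul_self_mulVec] at this
    exact dotProduct_star_self_eq_zero.mp this
  · have := h0.2
    rw [hV] at this
    exact dotProduct_star_self_eq_zero.mp this

/-! ### Low-energy spaces -/

section LowEnergy

variable {m : ℕ} {H : QOp m} {Δ : ℝ}

lemma toEuclideanLin_lowEnergyProj (x : EuclideanSpace ℂ (Fin m → Fin 2)) :
    toEuclideanLin (lowEnergyProj H Δ) x = (lowEnergySpace H Δ).starProjection x := by
  rw [lowEnergyProj, LinearEquiv.apply_symm_apply]; rfl

lemma toEuclideanLin_mem_lowEnergySpace {x : EuclideanSpace ℂ (Fin m → Fin 2)}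
    (hx : x ∈ lowEnergySpace H Δ) : toEuclideanLin H x ∈ lowEnergySpace H Δ := by
  refine Submodule.iSup_induction' (motive := fun x _ => toEuclideanLin H x ∈ lowEnergySpace H Δ)
    _ ?_ (by simp) (fun x y _ _ hx hy => by rw [map_add]; exact add_mem hx hy) hx
  intro lam x hx
  rcases em (lam ≤ Δ) with h | h
  · simp only [h, iSup_pos] at hx
    rw [Module.End.mem_eigenspace_iff.mp hx]
    refine Submodule.smul_mem _ _ ?_
    exact (le_iSup₂_of_le (f := fun (lam : ℝ) (_ : lam ≤ Δ) =>
      Module.End.eigenspace (toEuclideanLin H) (lam : ℂ)) lam h le_rfl) hx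
  · simp only [h, iSup_false, Submodule.mem_bot] at hx
    simp [hx]

lemma lowEnergyProj_isHermitian : (lowEnergyProj H Δ)ᴴ = lowEnergyProj H Δ := by
  apply toEuclideanLin.injective
  rw [toEuclideanLin_conjTranspose_eq_adjoint]
  symm
  rw [LinearMap.eq_adjoint_iff]
  intro x y
  rw [toEuclideanLin_lowEnergyProj, toEuclideanLin_lowEnergyProj]
  exact Submodule.inner_starProjection_left_eq_right _ x y

lemma lowEnergyProj_mul_self : lowEnergyProj H Δ * lowEnergyProj H Δ = lowEnergyProj H Δ := by
  apply toEuclideanLin.injective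
  ext1 x
  rw [toEuclideanLin_mul_apply, toEuclideanLin_lowEnergyProj, toEuclideanLin_lowEnergyProj]
  exact Submodule.starProjection_eq_self_iff.mpr (Submodule.starProjection_apply_mem _ x)

variable (hH : H.IsHermitian)
include hH

lemma lowEnergyProj_commute : H * lowEnergyProj H Δ = lowEnergyProj H Δ * H := by
  have h : H * lowEnergyProj H Δ = lowEnergyProj H Δ * (H * lowEnergyProj H Δ) := by
    apply toEuclideanLin.injective
    ext1 x
    rw [toEuclideanLin_mul_apply, toEuclideanLin_mul_apply, toEuclideanLin_mul_apply,
      toEuclideanLin_lowEnergyProj, toEuclideanLin_lowEnergyProj]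
    exact (Submodule.starProjection_eq_self_iff.mpr
      (toEuclideanLin_mem_lowEnergySpace (Submodule.starProjection_apply_mem _ x))).symm
  have h' := congrArg conjTranspose h
  simp only [conjTranspose_mul, lowEnergyProj_isHermitian, hH.eq] at h'
  rw [h, h', Matrix.mul_assoc]

/-- An eigenvector with eigenvalue above the cut-off is orthogonal to the low-energy space. -/
lemma inner_eq_zero_of_mem_lowEnergySpace {lam : ℝ} (hlam : Δ < lam)
    {x y : EuclideanSpace ℂ (Fin m → Fin 2)} (hy : toEuclideanLin H y = (lam : ℂ) • y)
    (hx : x ∈ lowEnergySpace H Δ) : inner ℂ y x = 0 := by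
  refine Submodule.iSup_induction' (motive := fun x _ => inner ℂ y x = 0)
    _ ?_ (by simp) (fun x z _ _ hx hz => by rw [inner_add_right, hx, hz, add_zero]) hx
  intro mu x hx
  rcases em (mu ≤ Δ) with h | h
  · simp only [h, iSup_pos] at hx
    have h1 := inner_toEuclideanLin_right H y x
    rw [hH.eq, hy, Module.End.mem_eigenspace_iff.mp hx, inner_smul_left, inner_smul_right,
      Complex.conj_ofReal, ← sub_eq_zero, ← sub_mul] at h1
    refine (mul_eq_zero.mp h1).resolve_left ?_
    rw [sub_eq_zero]
    exact_mod_cast (h.trans_lt hlam).ne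
  · simp only [h, iSup_false, Submodule.mem_bot] at hx
    simp [hx]

lemma re_inner_le_of_mem_lowEnergySpace {x : EuclideanSpace ℂ (Fin m → Fin 2)}
    (hx : x ∈ lowEnergySpace H Δ) :
    (inner ℂ x (toEuclideanLin H x)).re ≤ Δ * ‖x‖ ^ 2 := by
  have hs : (toEuclideanLin H).IsSymmetric := isSymmetric_toEuclideanLin_iff.mpr hH
  set b := hs.eigenvectorBasis rfl
  rw [← b.sum_inner_mul_inner, ← b.sum_sq_norm_inner_right, Complex.re_sum, Finset.mul_sum]
  refine Finset.sum_le_sum fun i _ => ?_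
  have hb : toEuclideanLin H (b i) = ((hs.eigenvalues rfl i : ℝ) : ℂ) • b i :=
    hs.apply_eigenvectorBasis rfl i
  rw [inner_toEuclideanLin_right, hH.eq, hb, inner_smul_left, Complex.conj_ofReal]
  rcases lt_or_ge Δ (hs.eigenvalues rfl i) with h | h
  · rw [inner_eq_zero_of_mem_lowEnergySpace hH h hb hx]; simp
  · rw [mul_left_comm, ← inner_conj_symm x, mul_comm ((starRingEnd ℂ) _), Complex.mul_conj,
      Complex.normSq_eq_norm_sq, ← Complex.ofReal_mul, Complex.ofReal_re]
    gcongr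

lemma norm_le_of_mem_lowEnergySpace_orthogonal (hΔ : 0 ≤ Δ)
    {x : EuclideanSpace ℂ (Fin m → Fin 2)}
    (hx : x ∈ (lowEnergySpace H Δ)ᗮ) : Δ * ‖x‖ ≤ ‖toEuclideanLin H x‖ := by
  have hs : (toEuclideanLin H).IsSymmetric := isSymmetric_toEuclideanLin_iff.mpr hH
  set b := hs.eigenvectorBasis rfl
  refine le_of_sq_le_sq ?_ (norm_nonneg _)
  rw [mul_pow, ← b.sum_sq_norm_inner_right, ← b.sum_sq_norm_inner_right, Finset.mul_sum]
  refine Finset.sum_le_sum fun i _ => ?_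
  have hb : toEuclideanLin H (b i) = ((hs.eigenvalues rfl i : ℝ) : ℂ) • b i :=
    hs.apply_eigenvectorBasis rfl i
  rw [inner_toEuclideanLin_right, hH.eq, hb, inner_smul_left, Complex.conj_ofReal, norm_mul,
    mul_pow]
  rcases lt_or_ge Δ (hs.eigenvalues rfl i) with h | h
  · rw [Complex.norm_real, Real.norm_eq_abs, sq_abs]
    gcongr
  · have hmem : b i ∈ lowEnergySpace H Δ :=
      (le_iSup₂_of_le (f := fun (lam : ℝ) (_ : lam ≤ Δ) =>
        Module.End.eigenspace (toEuclideanLin H) (lam : ℂ)) _ h le_rfl)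
        (Module.End.mem_eigenspace_iff.mpr hb)
    rw [Submodule.inner_right_of_mem_orthogonal hmem hx]; simp

/-- `H` expands by at least `Δ` on the complement of the low-energy space. -/
lemma mul_norm_one_sub_lowEnergyProj_mul_le {a : Type*} [Fintype a] [DecidableEq a] (hΔ : 0 < Δ)
    (T : Matrix (Fin m → Fin 2) a ℂ) :
    Δ * ‖(1 - lowEnergyProj H Δ) * T‖ ≤ ‖H * ((1 - lowEnergyProj H Δ) * T)‖ := by
  rw [← le_div_iff₀' hΔ]
  refine l2_opNorm_le_of_forall (by positivity) fun x => ?_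
  rw [div_mul_eq_mul_div, le_div_iff₀' hΔ]
  refine le_trans ?_ (norm_toEuclideanLin_le _ x)
  rw [toEuclideanLin_mul_apply H]
  refine norm_le_of_mem_lowEnergySpace_orthogonal hH hΔ.le ?_
  rw [toEuclideanLin_mul_apply, map_sub, LinearMap.sub_apply, toEuclideanLin_one_apply,
    toEuclideanLin_lowEnergyProj]
  exact Submodule.sub_starProjection_mem_orthogonal _

end LowEnergy

/-! ### Second-order perturbation theory -/

section Perturbation

variable {m : ℕ} {a : Type*} [Fintype a] [DecidableEq a]

/-- An approximate intertwiner `T` between `H` and `H'`, close to the isometry `V`, can be turned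
into an isometry onto the low-energy space of `H'` that intertwines the two up to a small error, as
soon as no low-energy vector is orthogonal to the range of `T`: take the isometric part of the
polar decomposition of the projection of `T` to the low-energy space. -/
lemma exists_isometry_of_approx_intertwiner [Nonempty a] {H' : QOp m} (hH' : H'.IsHermitian)
    {H : Matrix a a ℂ} {V T : Matrix (Fin m → Fin 2) a ℂ} {Δ δ : ℝ} (hV : Vᴴ * V = 1)
    (hΔ : ‖H‖ + 1 ≤ Δ) (hδ : δ ≤ 1 / 12) (hT : ‖H' * T - T * H‖ ≤ δ) (hTV : ‖T - V‖ ≤ δ)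
    (hinj : ∀ x ∈ lowEnergySpace H' Δ, toEuclideanLin Tᴴ x = 0 → x = 0) :
    ∃ V' : Matrix (Fin m → Fin 2) a ℂ, V'ᴴ * V' = 1 ∧ V' * V'ᴴ = lowEnergyProj H' Δ ∧
      ‖V' - V‖ ≤ 14 * δ ∧
      ‖H' * lowEnergyProj H' Δ - V' * H * V'ᴴ‖ ≤ (2 + 24 * ‖H‖) * δ := by
  set P := lowEnergyProj H' Δ with hP
  have hPP : P * P = P := lowEnergyProj_mul_self
  have hPh : Pᴴ = P := lowEnergyProj_isHermitian
  have hcomm : H' * P = P * H' := lowEnergyProj_commute hH'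
  have hδ0 : 0 ≤ δ := (norm_nonneg _).trans hTV
  have hΔ0 : 0 < Δ := by linarith [norm_nonneg H]
  have hVn : ‖V‖ ≤ 1 := l2_opNorm_isometry_le_one hV
  have hPn : ‖P‖ ≤ 1 := by
    have h := l2_opNorm_conjTranspose_mul_self P
    rw [hPh, hPP] at h
    nlinarith [norm_nonneg P]
  have hQn : ‖1 - P‖ ≤ 1 := by
    have h := l2_opNorm_conjTranspose_mul_self (1 - P)
    have h2 : (1 - P)ᴴ * (1 - P) = 1 - P := by
      rw [conjTranspose_sub, hPh, conjTranspose_one, Matrix.mul_sub, Matrix.sub_mul,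
        Matrix.sub_mul, hPP]
      simp
    rw [h2] at h
    nlinarith [norm_nonneg (1 - P)]
  -- the component `K` of `T` at high energies is small, since `H' * K - K * H` is
  have hK : ‖(1 - P) * T‖ ≤ δ := by
    have h1 : H' * ((1 - P) * T) = (1 - P) * (H' * T - T * H) + (1 - P) * T * H := by
      rw [Matrix.mul_sub, ← Matrix.mul_assoc, ← Matrix.mul_assoc, Matrix.mul_sub, hcomm,
        Matrix.sub_mul, Matrix.sub_mul, Matrix.sub_mul, Matrix.mul_one, Matrix.one_mul]
      simp only [Matrix.sub_mul, Matrix.mul_assoc, Matrix.one_mul]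
      abel
    have h2 := mul_norm_one_sub_lowEnergyProj_mul_le hH' hΔ0 T
    rw [← hP, h1] at h2
    have h3 : ‖(1 - P) * (H' * T - T * H)‖ ≤ 1 * δ := l2_opNorm_mul_le_of_le hQn hT
    have h4 := l2_opNorm_mul ((1 - P) * T) H
    have h5 := norm_add_le ((1 - P) * (H' * T - T * H)) ((1 - P) * T * H)
    nlinarith [norm_nonneg ((1 - P) * T)]
  set A := P * T with hA
  have hPA : P * A = A := by rw [hA, ← Matrix.mul_assoc, hPP]
  have hAV : ‖A - V‖ ≤ 2 * δ := by
    have h1 : A - V = (T - V) - (1 - P) * T := by rw [Matrix.sub_mul, Matrix.one_mul]; abel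
    rw [h1]
    linarith [norm_sub_le (T - V) ((1 - P) * T)]
  have hAn : ‖A‖ ≤ 7 / 6 := by
    have h1 : A = (A - V) + V := by abel
    rw [h1]
    linarith [norm_add_le (A - V) V]
  have hG : ‖Aᴴ * A - 1‖ ≤ 6 * δ := by
    have h1 : Aᴴ * A - 1 = Aᴴ * (A - V) + (A - V)ᴴ * V := by
      rw [← hV, conjTranspose_sub, Matrix.mul_sub, Matrix.sub_mul]; abel
    rw [h1]
    have h2 := l2_opNorm_mul Aᴴ (A - V)
    have h3 := l2_opNorm_mul (A - V)ᴴ V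
    rw [l2_opNorm_conjTranspose] at h2 h3
    have h4 := norm_add_le (Aᴴ * (A - V)) ((A - V)ᴴ * V)
    have h5 : ‖A‖ * ‖A - V‖ ≤ 7 / 6 * (2 * δ) := by gcongr
    have h6 : ‖A - V‖ * ‖V‖ ≤ 2 * δ * 1 := by gcongr
    linarith
  obtain ⟨s, r, hrs, -, hs, hiso, hs1⟩ := exists_polar A (by linarith) hG
  have hV'n : ‖A * s‖ ≤ 1 := l2_opNorm_isometry_le_one hiso
  have hsn : ‖s‖ ≤ 3 / 2 := by
    have h1 : s = (s - 1) + 1 := by abel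
    rw [h1]
    have := norm_add_le (s - 1) 1
    rw [CStarRing.norm_one] at this
    linarith
  -- the complement `N` of the range of `A * s` in the low-energy space is orthogonal to that of `T`
  have hrange : (A * s) * (A * s)ᴴ = P := by
    symm
    rw [← sub_eq_zero]
    set N := P - (A * s) * (A * s)ᴴ with hN
    have hPN : P * N = N := by
      rw [hN, Matrix.mul_sub, hPP, ← Matrix.mul_assoc, ← Matrix.mul_assoc, hPA]
    have hVN : (A * s)ᴴ * N = 0 := by
      have h1 : (A * s)ᴴ * P = (A * s)ᴴ := by
        have := congrArg conjTranspose hPA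
        rw [conjTranspose_mul, hPh] at this
        rw [conjTranspose_mul, Matrix.mul_assoc, this]
      rw [hN, Matrix.mul_sub, h1, ← Matrix.mul_assoc, hiso, Matrix.one_mul, sub_self]
    have hAN : Tᴴ * N = 0 := by
      have h1 : Tᴴ * N = Aᴴ * N := by
        rw [hA, conjTranspose_mul, hPh, Matrix.mul_assoc, hPN]
      rw [h1, ← Matrix.one_mul (Aᴴ * N), ← hrs, Matrix.mul_assoc, ← Matrix.mul_assoc s]
      rw [conjTranspose_mul, hs] at hVN
      rw [hVN, Matrix.mul_zero]
    apply toEuclideanLin.injective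
    ext1 x
    rw [map_zero, LinearMap.zero_apply]
    apply hinj
    · rw [← hPN, toEuclideanLin_mul_apply, toEuclideanLin_lowEnergyProj]
      exact Submodule.starProjection_apply_mem _ _
    · rw [← toEuclideanLin_mul_apply, hAN, map_zero, LinearMap.zero_apply]
  refine ⟨A * s, hiso, hrange, ?_, ?_⟩
  · have h1 : A * s - V = A * (s - 1) + (A - V) := by
      rw [Matrix.mul_sub, Matrix.mul_one]; abel
    rw [h1]
    have h2 := norm_add_le (A * (s - 1)) (A - V)
    have h3 : ‖A * (s - 1)‖ ≤ 7 / 6 * (6 * δ) := l2_opNorm_mul_le_of_le hAn hs1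
    linarith
  · have h1 : H' * P - A * s * H * (A * s)ᴴ
        = (P * (H' * T - T * H) * s + A * (H * (s - 1) - (s - 1) * H)) * (A * s)ᴴ := by
      have h2 : H' * P = P * (H' * T) * s * (A * s)ᴴ := by
        calc H' * P = H' * (A * s * (A * s)ᴴ) := by rw [hrange]
          _ = H' * A * s * (A * s)ᴴ := by simp only [Matrix.mul_assoc]
          _ = P * (H' * T) * s * (A * s)ᴴ := by
            rw [hA, ← Matrix.mul_assoc H', hcomm, Matrix.mul_assoc P]
      rw [h2, ← Matrix.sub_mul]
      congr 1
      simp only [Matrix.mul_sub, Matrix.sub_mul, hA, Matrix.mul_assoc, Matrix.mul_one,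
        Matrix.one_mul]
      abel
    rw [h1]
    have h2 : ‖P * (H' * T - T * H) * s‖ ≤ 1 * δ * (3 / 2) :=
      l2_opNorm_mul_le_of_le (l2_opNorm_mul_le_of_le hPn hT) hsn
    have h3 : ‖H * (s - 1) - (s - 1) * H‖ ≤ 2 * (‖H‖ * (6 * δ)) := by
      have h4 : ‖H * (s - 1)‖ ≤ ‖H‖ * (6 * δ) := l2_opNorm_mul_le_of_le le_rfl hs1
      have h5 : ‖(s - 1) * H‖ ≤ (6 * δ) * ‖H‖ := l2_opNorm_mul_le_of_le hs1 le_rfl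
      linarith [norm_sub_le (H * (s - 1)) ((s - 1) * H)]
    have h6 : ‖A * (H * (s - 1) - (s - 1) * H)‖ ≤ 7 / 6 * (2 * (‖H‖ * (6 * δ))) :=
      l2_opNorm_mul_le_of_le hAn h3
    have h7 := l2_opNorm_mul
      (P * (H' * T - T * H) * s + A * (H * (s - 1) - (s - 1) * H)) (A * s)ᴴ
    rw [l2_opNorm_conjTranspose] at h7
    have h8 := norm_add_le (P * (H' * T - T * H) * s) (A * (H * (s - 1) - (s - 1) * H))
    have h9 : 0 ≤ ‖H‖ * δ := by positivity
    have h10 := mul_le_of_le_one_right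
      (norm_nonneg (P * (H' * T - T * H) * s + A * (H * (s - 1) - (s - 1) * H))) hV'n
    nlinarith

/-- Second-order perturbation theory. Let `V` be an isometry onto the kernel of `H₀ ≥ 0`, and let
`H₂` map this kernel into the eigenspace of `H₀` for the eigenvalue `e ≠ 0`. Then the low-energy
part of `t⁻² H₀ + t⁻¹ H₂ + H₁` is, for small `t`, the operator `Vᴴ H₁ V - e⁻¹ Vᴴ H₂² V`.

The approximate intertwiner is `V - t R - t² S`, where `H₀ R = H₂ V`, and where `S` cancels the part
of `H₁ V - H₂ R` outside the kernel. -/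
theorem exists_perturbation [Nonempty a] {H₀ H₁ H₂ : QOp m} {H : Matrix a a ℂ}
    {V : Matrix (Fin m → Fin 2) a ℂ} {e : ℝ}
    (h₀ : H₀.IsHermitian) (h₁ : H₁.IsHermitian) (h₂ : H₂.IsHermitian) (hV : Vᴴ * V = 1)
    (hker : H₀ * V = 0) (hpos : (H₀ + V * Vᴴ).PosDef) (he : e ≠ 0)
    (hexc : H₀ * (H₂ * V) = (e : ℂ) • (H₂ * V))
    (heff : Vᴴ * (H₁ * V) - (e : ℂ)⁻¹ • (Vᴴ * (H₂ * (H₂ * V))) = H)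
    {Δ η ε : ℝ} (hΔ : ‖H‖ + 1 ≤ Δ) (hη : 0 < η) (hε : 0 < ε) :
    ∃ t : ℝ, 0 < t ∧ ∃ V' : Matrix (Fin m → Fin 2) a ℂ, V'ᴴ * V' = 1 ∧
      V' * V'ᴴ = lowEnergyProj ((t ^ 2)⁻¹ • H₀ + t⁻¹ • H₂ + H₁) Δ ∧ ‖V' - V‖ ≤ η ∧
      ‖((t ^ 2)⁻¹ • H₀ + t⁻¹ • H₂ + H₁) * lowEnergyProj ((t ^ 2)⁻¹ • H₀ + t⁻¹ • H₂ + H₁) Δ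
        - V' * H * V'ᴴ‖ ≤ ε := by
  obtain ⟨g, hg, hgap⟩ := exists_pos_forall_le_re_inner hpos
  have heC : (e : ℂ) ≠ 0 := by exact_mod_cast he
  set R := (e : ℂ)⁻¹ • (H₂ * V) with hR
  have hH₀R : H₀ * R = H₂ * V := by
    rw [hR, Matrix.mul_smul, hexc, smul_smul, inv_mul_cancel₀ heC, one_smul]
  set Y := H₁ * V - H₂ * R with hY
  have hVY : Vᴴ * Y = H := by
    rw [hY, hR, Matrix.mul_sub, Matrix.mul_smul, Matrix.mul_smul, heff]
  have hVH₀ : Vᴴ * H₀ = 0 := by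
    have := congrArg conjTranspose hker
    rwa [conjTranspose_mul, h₀.eq, conjTranspose_zero] at this
  obtain ⟨S, hS⟩ : ∃ S : Matrix (Fin m → Fin 2) a ℂ, H₀ * S = Y - V * H := by
    -- `H₀ + V * Vᴴ` is an invertible extension of `H₀` from the complement of its kernel
    set B := H₀ + V * Vᴴ with hB
    have hdet : IsUnit B.det := (Matrix.isUnit_iff_isUnit_det _).mp hpos.isUnit
    refine ⟨B⁻¹ * (Y - V * H), ?_⟩
    have h1 : B * (B⁻¹ * (Y - V * H)) = Y - V * H := by
      rw [← Matrix.mul_assoc, mul_nonsing_inv _ hdet, Matrix.one_mul]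
    have h2 : Vᴴ * B = Vᴴ := by
      rw [hB, Matrix.mul_add, hVH₀, ← Matrix.mul_assoc, hV, Matrix.one_mul, zero_add]
    have h3 : Vᴴ * (B⁻¹ * (Y - V * H)) = 0 := by
      rw [← h2, Matrix.mul_assoc, h1, Matrix.mul_sub, hVY, ← Matrix.mul_assoc, hV, Matrix.one_mul,
        sub_self]
    have h4 : H₀ = B - V * Vᴴ := by rw [hB]; abel
    rw [h4, Matrix.sub_mul, h1, Matrix.mul_assoc, h3, Matrix.mul_zero, sub_zero]
  -- the errors are at most `C * t` for `t ≤ 1`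
  set C := (‖R‖ + ‖S‖) + (‖R * H - H₂ * S - H₁ * R‖ + ‖S * H - H₁ * S‖) with hC
  set D := C ^ 2 + ‖H₂‖ + ‖H₁‖ + |Δ| with hD
  obtain ⟨t, ht0, ht1, htη, htε, ht12, htg⟩ : ∃ t : ℝ, 0 < t ∧ t ≤ 1 ∧ 14 * (C * t) ≤ η ∧
      (2 + 24 * ‖H‖) * (C * t) ≤ ε ∧ C * t ≤ 1 / 12 ∧ t * D < g := by
    have hev : ∀ c d : ℝ, 0 < d → ∀ᶠ t in nhdsWithin (0 : ℝ) (Set.Ioi 0), c * t < d := by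
      intro c d hd
      have h : Filter.Tendsto (fun t : ℝ => c * t) (nhdsWithin 0 (Set.Ioi 0)) (nhds (c * 0)) :=
        ((continuous_const.mul continuous_id).tendsto 0).mono_left nhdsWithin_le_nhds
      rw [mul_zero] at h
      exact h.eventually (gt_mem_nhds hd)
    have h := ((((eventually_mem_nhdsWithin (a := (0 : ℝ)) (s := Set.Ioi 0)).and
      (hev 1 1 one_pos)).and
      (hev (14 * C) η hη)).and (hev ((2 + 24 * ‖H‖) * C) ε hε)).and
      ((hev C (1 / 12) (by norm_num)).and (hev D g hg))
    obtain ⟨t, ⟨⟨⟨h1, h2⟩, h3⟩, h4⟩, h5, h6⟩ := h.exists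
    refine ⟨t, h1, by linarith, by linarith, ?_, h5.le, by linarith⟩
    rw [← mul_assoc]; exact h4.le
  refine ⟨t, ht0, ?_⟩
  set H' := (t ^ 2)⁻¹ • H₀ + t⁻¹ • H₂ + H₁ with hH'
  have hH'h : H'.IsHermitian := by
    refine ((IsHermitian.smul h₀ ?_).add (IsHermitian.smul h₂ ?_)).add h₁ <;>
    exact IsSelfAdjoint.all _
  set T := V - t • R - t ^ 2 • S with hT
  have hnt : ‖t‖ = t := by rw [Real.norm_eq_abs, abs_of_pos ht0]
  have htt : t ^ 2 ≤ t := by nlinarith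
  have hsm : ∀ M N : Matrix (Fin m → Fin 2) a ℂ, ‖t • M + t ^ 2 • N‖ ≤ (‖M‖ + ‖N‖) * t := by
    intro M N
    refine (norm_add_le _ _).trans ?_
    rw [norm_smul, norm_smul, norm_pow, hnt]
    nlinarith [norm_nonneg M, norm_nonneg N]
  have hTV : ‖V - T‖ ≤ C * t := by
    have h1 : V - T = t • R + t ^ 2 • S := by rw [hT]; abel
    rw [h1]
    refine (hsm R S).trans ?_
    gcongr
    rw [hC]
    linarith [norm_nonneg (R * H - H₂ * S - H₁ * R), norm_nonneg (S * H - H₁ * S)]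
  -- the terms of order `t⁻¹` and `1` cancel by the choice of `R` and `S`
  have hint : H' * T - T * H
      = t • (R * H - H₂ * S - H₁ * R) + t ^ 2 • (S * H - H₁ * S) := by
    have h1 : H' * T = t⁻¹ • (H₂ * V) - t⁻¹ • (H₀ * R) - (H₀ * S) - H₂ * R - t • (H₂ * S) + H₁ * V
        - t • (H₁ * R) - t ^ 2 • (H₁ * S) := by
      rw [hH', hT]
      simp only [Matrix.add_mul, Matrix.mul_sub, Matrix.smul_mul, Matrix.mul_smul, smul_smul, hker,
        smul_zero, smul_add]
      rw [show t * (t ^ 2)⁻¹ = t⁻¹ by field_simp, show t ^ 2 * (t ^ 2)⁻¹ = 1 by field_simp,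
        show t * t⁻¹ = 1 by field_simp, show t ^ 2 * t⁻¹ = t by field_simp, one_smul, one_smul]
      abel
    rw [h1, hH₀R, hS, hY, hT]
    simp only [Matrix.sub_mul, Matrix.smul_mul, smul_sub]
    abel
  obtain ⟨V', hV', hP, hn, hm⟩ := exists_isometry_of_approx_intertwiner hH'h (T := T)
    (δ := C * t) hV hΔ ht12 (by
      rw [hint]
      refine (hsm _ _).trans ?_
      gcongr
      rw [hC]
      linarith [norm_nonneg R, norm_nonneg S]) (by rw [norm_sub_rev]; exact hTV) (by
      intro x hx hTx
      -- such an `x` is almost orthogonal to the kernel of `H₀`, and so of high energy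
      by_contra hx0
      have hxn : 0 < ‖x‖ := norm_pos_iff.mpr hx0
      have h1 : ‖toEuclideanLin Vᴴ x‖ ≤ C * t * ‖x‖ := by
        have h2 : toEuclideanLin Vᴴ x = toEuclideanLin (V - T)ᴴ x := by
          rw [conjTranspose_sub, map_sub, LinearMap.sub_apply, hTx, sub_zero]
        rw [h2]
        refine (norm_toEuclideanLin_le _ x).trans ?_
        rw [l2_opNorm_conjTranspose]
        gcongr
      have h3 := hgap x
      have h4 : (inner ℂ x (toEuclideanLin (V * Vᴴ) x)).re = ‖toEuclideanLin Vᴴ x‖ ^ 2 := by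
        rw [← re_inner_conjTranspose_mul_self, conjTranspose_conjTranspose]
      rw [map_add, LinearMap.add_apply, inner_add_right, Complex.add_re, h4] at h3
      have h5 := re_inner_le_of_mem_lowEnergySpace hH'h hx
      have h6 : (inner ℂ x (toEuclideanLin H' x)).re
          = (t ^ 2)⁻¹ * (inner ℂ x (toEuclideanLin H₀ x)).re
            + t⁻¹ * (inner ℂ x (toEuclideanLin H₂ x)).re
            + (inner ℂ x (toEuclideanLin H₁ x)).re := by
        rw [hH', map_add, map_add, LinearMap.add_apply, LinearMap.add_apply,
          toEuclideanLin_real_smul, toEuclideanLin_real_smul,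
          inner_add_right, inner_add_right, inner_smul_right, inner_smul_right, Complex.add_re,
          Complex.add_re, Complex.re_ofReal_mul, Complex.re_ofReal_mul]
      have h7 := (abs_le.mp (abs_re_inner_toEuclideanLin_le H₂ x)).1
      have h8 := (abs_le.mp (abs_re_inner_toEuclideanLin_le H₁ x)).1
      have h9 : ‖toEuclideanLin Vᴴ x‖ ^ 2 ≤ (C * t * ‖x‖) ^ 2 := by gcongr
      rw [h6] at h5
      set q₀ := (inner ℂ x (toEuclideanLin H₀ x)).re
      set q₁ := (inner ℂ x (toEuclideanLin H₁ x)).re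
      set q₂ := (inner ℂ x (toEuclideanLin H₂ x)).re
      have h10 : q₀ + t * q₂ + t ^ 2 * q₁ ≤ t ^ 2 * (Δ * ‖x‖ ^ 2) := by
        have := mul_le_mul_of_nonneg_left h5 (sq_nonneg t)
        have h11 : t ^ 2 * ((t ^ 2)⁻¹ * q₀ + t⁻¹ * q₂ + q₁) = q₀ + t * q₂ + t ^ 2 * q₁ := by
          field_simp
        linarith
      set n := ‖x‖ ^ 2 with hn
      have hn0 : 0 < n := by positivity
      have h12 : g * n ≤ (C * t) ^ 2 * n + t * (‖H₂‖ * n) + t ^ 2 * (‖H₁‖ * n)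
          + t ^ 2 * (|Δ| * n) := by
        have e1 := mul_le_mul_of_nonneg_left h7 ht0.le
        have e2 := mul_le_mul_of_nonneg_left h8 (sq_nonneg t)
        have e3 : t ^ 2 * (Δ * n) ≤ t ^ 2 * (|Δ| * n) := by
          gcongr; exact le_abs_self Δ
        rw [mul_pow (C * t)] at h9
        linarith
      have h13 : g * n ≤ (t * D) * n := by
        refine h12.trans ?_
        have e1 : t ^ 2 * (C ^ 2 * n) ≤ t * (C ^ 2 * n) := by gcongr
        have e2 : t ^ 2 * (‖H₁‖ * n) ≤ t * (‖H₁‖ * n) := by gcongr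
        have e3 : t ^ 2 * (|Δ| * n) ≤ t * (|Δ| * n) := by gcongr
        rw [hD, mul_pow]
        linarith
      exact absurd (le_of_mul_le_mul_right h13 hn0) (not_le.mpr htg))
  exact ⟨V', hV', hP, hn.trans htη, hm.trans htε⟩

end Perturbation

/-! ### Tensor products over a finite index set -/

section Tensor

variable {ι K L M : Type} [Fintype ι] [DecidableEq ι] [Fintype K] [DecidableEq K]
  [Fintype L] [DecidableEq L]

/-- The tensor product `⨂ i, A i` of matrices, with rows and columns indexed by functions on the
index set. -/
def tens (A : ι → Matrix K L ℂ) : Matrix (ι → K) (ι → L) ℂ :=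
  Matrix.of fun s t => ∏ i, A i (s i) (t i)

lemma tens_apply (A : ι → Matrix K L ℂ) (s : ι → K) (t : ι → L) :
    tens A s t = ∏ i, A i (s i) (t i) := rfl

lemma tens_mul (A : ι → Matrix K L ℂ) (B : ι → Matrix L M ℂ) :
    tens A * tens B = tens fun i => A i * B i := by
  ext s t
  simp only [Matrix.mul_apply, tens_apply, Finset.prod_univ_sum, Fintype.piFinset_univ,
    Finset.prod_mul_distrib]

lemma tens_conjTranspose (A : ι → Matrix K L ℂ) : (tens A)ᴴ = tens fun i => (A i)ᴴ := by
  ext s t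
  simp [tens_apply]

lemma tens_one : tens (fun _ : ι => (1 : Matrix K K ℂ)) = 1 := by
  ext s t
  simp [tens_apply, Matrix.one_apply, Finset.prod_ite_zero, funext_iff]

lemma tens_eq_zero {A : ι → Matrix K L ℂ} (i : ι) (h : A i = 0) : tens A = 0 := by
  ext s t
  exact Finset.prod_eq_zero (Finset.mem_univ i) (by simp [h])

lemma onSite_eq_tens (j : ι) (A : Matrix K K ℂ) :
    onSite (κ := fun _ : ι => K) j A = tens (Function.update (fun _ => 1) j A) := by
  ext s t
  rw [tens_apply, ← Finset.mul_prod_erase _ _ (Finset.mem_univ j), Function.update_self]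
  have h : ∀ i ∈ Finset.univ.erase j, Function.update (fun _ => (1 : Matrix K K ℂ)) j A i (s i) (t i)
      = if s i = t i then 1 else 0 := by
    intro i hi
    rw [Function.update_of_ne (Finset.ne_of_mem_erase hi), Matrix.one_apply]
  rw [Finset.prod_congr rfl h, Finset.prod_ite_zero]
  simp [onSite]

/-- Placing an operator on the tensor factor `j`, as a homomorphism of star algebras. -/
def siteHom (j : ι) : Matrix K K ℂ →⋆ₐ[ℂ] Matrix (ι → K) (ι → K) ℂ where
  toFun A := onSite (κ := fun _ : ι => K) j A
  map_one' := by
    rw [onSite_eq_tens, ← tens_one]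
    congr 1
    exact Function.update_eq_self j _
  map_mul' A B := by
    rw [onSite_eq_tens, onSite_eq_tens, onSite_eq_tens, tens_mul]
    congr 1
    funext i
    by_cases h : i = j
    · subst h; simp
    · simp [h]
  map_zero' := by ext s t; simp [onSite]
  map_add' A B := by ext s t; simp [onSite]; split_ifs <;> simp
  commutes' c := by
    ext s t
    simp only [onSite, algebraMap_matrix_apply, Matrix.of_apply]
    by_cases h : s = t
    · simp [h]
    · rw [if_neg h]
      split_ifs with h1 h2
      · exact absurd (funext fun i => by
          by_cases hi : i = j
          · exact hi ▸ h2
          · exact h1 i hi) h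
      · rfl
      · rfl
  map_star' A := by
    simp only [star_eq_conjTranspose]
    rw [onSite_eq_tens, onSite_eq_tens, tens_conjTranspose]
    congr 1
    funext i
    by_cases h : i = j
    · subst h; simp
    · simp [h]

lemma siteHom_apply (j : ι) (A : Matrix K K ℂ) :
    siteHom j A = onSite (κ := fun _ : ι => K) j A := rfl

lemma siteHom_eq_tens (j : ι) (A : Matrix K K ℂ) :
    siteHom j A = tens (Function.update (fun _ : ι => 1) j A) := onSite_eq_tens j A

lemma siteHom_conjTranspose (j : ι) (A : Matrix K K ℂ) : (siteHom j A)ᴴ = siteHom j Aᴴ :=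
  (map_star (siteHom j) A).symm

lemma siteHom_comm {i j : ι} (h : i ≠ j) (A B : Matrix K K ℂ) :
    siteHom i A * siteHom j B = siteHom j B * siteHom i A := by
  simp only [siteHom_eq_tens, tens_mul]
  congr 1
  funext x
  by_cases hi : x = i
  · subst hi; simp [h]
  · simp [hi]

/-- An operator on one tensor factor acts on the corresponding index only. -/
lemma siteHom_mul_apply (j : ι) (A : Matrix K K ℂ) (B : Matrix (ι → K) M ℂ) (s : ι → K) (k : M) :
    (siteHom j A * B) s k = ∑ u, A (s j) u * B (Function.update s j u) k := by
  rw [Matrix.mul_apply]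
  symm
  refine Finset.sum_of_injOn (fun u => Function.update s j u) ?_ ?_ ?_ ?_
  · intro u _ v _ h
    simpa using congrFun h j
  · simp
  · intro t _ ht
    rw [siteHom_apply, onSite, Matrix.of_apply, if_neg, zero_mul]
    intro h
    refine ht ⟨t j, by simp, ?_⟩
    funext i
    by_cases hi : i = j
    · subst hi; simp
    · simp [hi, h i hi]
  · intro u _
    rw [siteHom_apply, onSite, Matrix.of_apply, if_pos, Function.update_self]
    intro i hi
    simp [hi]

lemma siteHom_mulVec_apply (j : ι) (A : Matrix K K ℂ) (x : (ι → K) → ℂ) (s : ι → K) :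
    (siteHom j A *ᵥ x) s = ∑ u, A (s j) u * x (Function.update s j u) := by
  have h := siteHom_mul_apply j A (Matrix.of fun s (_ : Fin 1) => x s) s 0
  rw [Matrix.mul_apply] at h
  exact h

/-- The tensor power `W ⊗ ⋯ ⊗ W`. -/
def tpow (ι : Type) [Fintype ι] (W : Matrix K L ℂ) : Matrix (ι → K) (ι → L) ℂ :=
  tens fun _ : ι => W

variable {W : Matrix K L ℂ}

lemma tpow_isometry (hW : Wᴴ * W = 1) : (tpow ι W)ᴴ * tpow ι W = 1 := by
  rw [tpow, tens_conjTranspose, tens_mul, ← tens_one]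
  simp only [hW]

lemma siteHom_mul_tpow_eq_zero {j : ι} {A : Matrix K K ℂ} (h : A * W = 0) :
    siteHom j A * tpow ι W = 0 := by
  rw [siteHom_eq_tens, tpow, tens_mul]
  exact tens_eq_zero j (by simpa using h)

lemma siteHom_mul_tpow_congr {j : ι} {A B : Matrix K K ℂ} (h : A * W = B * W) :
    siteHom j A * tpow ι W = siteHom j B * tpow ι W := by
  rw [← sub_eq_zero, ← Matrix.sub_mul, ← map_sub]
  exact siteHom_mul_tpow_eq_zero (by rw [Matrix.sub_mul, h, sub_self])

lemma tpow_sandwich_one (hW : Wᴴ * W = 1) (j : ι) (A : Matrix K K ℂ) :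
    (tpow ι W)ᴴ * (siteHom j A * tpow ι W) = siteHom j (Wᴴ * (A * W)) := by
  simp only [siteHom_eq_tens, tpow, tens_conjTranspose, tens_mul]
  congr 1
  funext x
  by_cases hx : x = j
  · subst hx; simp
  · simp [hx, hW]

lemma tpow_sandwich_two (hW : Wᴴ * W = 1) {i j : ι} (hij : i ≠ j) (A B : Matrix K K ℂ) :
    (tpow ι W)ᴴ * ((siteHom i A * siteHom j B) * tpow ι W)
      = siteHom i (Wᴴ * (A * W)) * siteHom j (Wᴴ * (B * W)) := by
  simp only [siteHom_eq_tens, tpow, tens_conjTranspose, tens_mul]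
  congr 1
  funext x
  by_cases hx : x = i
  · subst hx; simp [hij]
  · by_cases hx' : x = j
    · subst hx'; simp [hx]
    · simp [hx, hx', hW]

/-- A single factor `A` with `Wᴴ A W = 0` on a site makes the compression by `W ⊗ ⋯ ⊗ W` vanish. -/
lemma tpow_sandwich_four_eq_zero {i j k l : ι} (hij : i ≠ j) (hik : i ≠ k) (hil : i ≠ l)
    {A : Matrix K K ℂ} (hA : Wᴴ * (A * W) = 0) (B C D : Matrix K K ℂ) :
    (tpow ι W)ᴴ * ((siteHom i A * siteHom j B * (siteHom k C * siteHom l D)) * tpow ι W) = 0 := by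
  simp only [siteHom_eq_tens, tpow, tens_conjTranspose, tens_mul]
  exact tens_eq_zero i (by simpa [hij, hik, hil] using hA)

/-- A vector that is fixed by the projector `Q` on every single tensor factor is fixed by
`Q ⊗ ⋯ ⊗ Q`. -/
lemma tpow_mulVec_eq_self {Q : Matrix K K ℂ} {x : (ι → K) → ℂ}
    (h : ∀ j, siteHom j Q *ᵥ x = x) : tpow ι Q *ᵥ x = x := by
  have key : ∀ s : Finset ι, tens (fun j => if j ∈ s then Q else 1) *ᵥ x = x := by
    intro s
    induction s using Finset.induction_on with
    | empty => simp [tens_one]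
    | insert i s hi ih =>
      have h1 : tens (fun j => if j ∈ insert i s then Q else 1)
          = siteHom i Q * tens (fun j => if j ∈ s then Q else 1) := by
        rw [siteHom_eq_tens, tens_mul]
        congr 1
        funext j
        by_cases hj : j = i
        · subst hj; simp [hi]
        · simp [hj]
      rw [h1, ← Matrix.mulVec_mulVec, ih, h]
  simpa [tpow] using key Finset.univ

end Tensor

/-! ### Pauli matrices and the total spin of four qubits -/

/-- The three Pauli matrices. -/
def pauli : Fin 3 → Matrix (Fin 2) (Fin 2) ℂ := ![pauliX, pauliY, pauliZ]

lemma pauli_conjTranspose (c : Fin 3) : (pauli c)ᴴ = pauli c := by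
  fin_cases c <;> ext i j <;> fin_cases i <;> fin_cases j <;>
    simp [pauli, pauliX, pauliY, pauliZ]

lemma pauli_mul_self (c : Fin 3) : pauli c * pauli c = 1 := by
  fin_cases c <;> ext i j <;> fin_cases i <;> fin_cases j <;>
    simp [pauli, pauliX, pauliY, pauliZ]

/-- Commutators with the third Pauli matrix take two distinct ones into multiples of each other, and
the first is a multiple of the commutator of the second and the third. -/
lemma exists_pauli_rotation {a b : Fin 3} (h : a ≠ b) : ∃ (c : Fin 3) (k : ℂ), k ≠ 0 ∧
    pauli c * pauli a - pauli a * pauli c = k • pauli b ∧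
    pauli c * pauli b - pauli b * pauli c = -k • pauli a ∧
    pauli b * pauli c - pauli c * pauli b = k • pauli a := by
  have key : ∀ (a b c : Fin 3) (s : ℂ), s ≠ 0 →
      pauli c * pauli a - pauli a * pauli c = (s * (2 * Complex.I)) • pauli b →
      pauli c * pauli b - pauli b * pauli c = -(s * (2 * Complex.I)) • pauli a →
      ∃ (c : Fin 3) (k : ℂ), k ≠ 0 ∧ pauli c * pauli a - pauli a * pauli c = k • pauli b ∧
        pauli c * pauli b - pauli b * pauli c = -k • pauli a ∧
        pauli b * pauli c - pauli c * pauli b = k • pauli a := by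
    intro a b c s hs h1 h2
    refine ⟨c, _, mul_ne_zero hs (by simp), h1, h2, ?_⟩
    rw [← neg_sub, h2, neg_smul, neg_neg]
  have c01 : pauli 0 * pauli 1 - pauli 1 * pauli 0 = (2 * Complex.I) • pauli 2 := by
    ext i j; fin_cases i <;> fin_cases j <;>
      simp [pauli, pauliX, pauliY, pauliZ] <;> ring
  have c12 : pauli 1 * pauli 2 - pauli 2 * pauli 1 = (2 * Complex.I) • pauli 0 := by
    ext i j; fin_cases i <;> fin_cases j <;>
      simp [pauli, pauliX, pauliY, pauliZ] <;> ring
  have c20 : pauli 2 * pauli 0 - pauli 0 * pauli 2 = (2 * Complex.I) • pauli 1 := by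
    ext i j; fin_cases i <;> fin_cases j <;>
      simp [pauli, pauliX, pauliY, pauliZ] <;>
      ring_nf <;> simp
  have c10 : pauli 1 * pauli 0 - pauli 0 * pauli 1 = -(2 * Complex.I) • pauli 2 := by
    rw [← neg_sub, c01, neg_smul]
  have c21 : pauli 2 * pauli 1 - pauli 1 * pauli 2 = -(2 * Complex.I) • pauli 0 := by
    rw [← neg_sub, c12, neg_smul]
  have c02 : pauli 0 * pauli 2 - pauli 2 * pauli 0 = -(2 * Complex.I) • pauli 1 := by
    rw [← neg_sub, c20, neg_smul]
  fin_cases a <;> fin_cases b <;> first | exact absurd rfl h | skip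
  · exact key 0 1 2 1 one_ne_zero (by rw [c20, one_mul]) (by rw [c21, one_mul])
  · exact key 0 2 1 (-1) (by simp) (by rw [c10]; simp) (by rw [c12]; simp)
  · exact key 1 0 2 (-1) (by simp) (by rw [c21]; simp) (by rw [c20]; simp)
  · exact key 1 2 0 1 one_ne_zero (by rw [c01, one_mul]) (by rw [c02, one_mul])
  · exact key 2 0 1 1 one_ne_zero (by rw [c12, one_mul]) (by rw [c10, one_mul])
  · exact key 2 1 0 (-1) (by simp) (by rw [c02]; simp) (by rw [c01]; simp)

/-- Twice rotated, a Pauli matrix returns to a multiple of itself. -/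
lemma pauli_double_commutator (c b : Fin 3) :
    pauli c * (pauli c * pauli b - pauli b * pauli c)
      - (pauli c * pauli b - pauli b * pauli c) * pauli c
      = (if c = b then 0 else 4 : ℂ) • pauli b := by
  fin_cases c <;> fin_cases b <;> ext i j <;> fin_cases i <;> fin_cases j <;>
    simp [pauli, pauliX, pauliY, pauliZ] <;> ring_nf <;> simp

/-- Twice the `c`-component of the total spin of four qubits. -/
def spin (c : Fin 3) : QOp 4 := ∑ i, siteHom i (pauli c)

lemma spin_conjTranspose (c : Fin 3) : (spin c)ᴴ = spin c := by
  rw [spin, conjTranspose_sum]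
  simp only [siteHom_conjTranspose, pauli_conjTranspose]

lemma spin_commutator (c : Fin 3) (i : Fin 4) (A : Matrix (Fin 2) (Fin 2) ℂ) :
    spin c * siteHom i A = siteHom i A * spin c + siteHom i (pauli c * A - A * pauli c) := by
  rw [spin, Matrix.sum_mul, Matrix.mul_sum, map_sub, map_mul, map_mul,
    ← Finset.add_sum_erase _ _ (Finset.mem_univ i),
    ← Finset.add_sum_erase _ (fun j => siteHom i A * siteHom j (pauli c)) (Finset.mem_univ i),
    Finset.sum_congr rfl fun j hj =>
      siteHom_comm (Finset.ne_of_mem_erase hj) (pauli c) A]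
  abel

lemma sum_vecCons {n : ℕ} (f : (Fin (n + 1) → Fin 2) → ℂ) :
    ∑ s, f s = ∑ a, ∑ t, f (Matrix.vecCons a t) := by
  rw [← (Fin.consEquiv fun _ => Fin 2).sum_comp, Fintype.sum_prod_type]
  rfl

lemma sum_four_qubits (f : (Fin 4 → Fin 2) → ℂ) :
    ∑ s, f s = ∑ a, ∑ b, ∑ c, ∑ d, f ![a, b, c, d] := by
  simp only [sum_vecCons, Fintype.sum_unique, Matrix.empty_eq]

lemma eq_vec_four (s : Fin 4 → Fin 2) : s = ![s 0, s 1, s 2, s 3] := by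
  ext i; fin_cases i <;> rfl

/-! ### The encoding of one qubit into the singlet space of four qubits -/

/-- The logical vectors attached to the three ways of pairing up four qubits. They add up to `0`. -/
noncomputable def pairVec : Fin 3 → Fin 2 → ℝ :=
  ![![0, 1 / √3], ![1 / 2, -(1 / (2 * √3))], ![-(1 / 2), -(1 / (2 * √3))]]

lemma sum_pairVec (k : Fin 2) : pairVec 0 k + pairVec 1 k + pairVec 2 k = 0 := by
  fin_cases k <;> simp [pairVec]
  field_simp; ring

/-- The three vectors form a tight frame, which makes the encoding isometric. -/
lemma sum_pairVec_mul (k l : Fin 2) :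
    2 * (pairVec 0 k * pairVec 0 l + pairVec 1 k * pairVec 1 l + pairVec 2 k * pairVec 2 l)
      = if k = l then 1 else 0 := by
  have h : (√3 : ℝ) ^ 2 = 3 := Real.sq_sqrt (by norm_num)
  fin_cases k <;> fin_cases l <;> simp [pairVec] <;> field_simp <;> nlinarith

lemma sum_pairVec_mul_complex (k l : Fin 2) :
    (2 : ℂ) * (pairVec 0 k * pairVec 0 l + pairVec 1 k * pairVec 1 l
      + pairVec 2 k * pairVec 2 l) = if k = l then 1 else 0 := by
  rw [← Complex.ofReal_one, ← Complex.ofReal_zero, ← apply_ite, ← sum_pairVec_mul k l]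
  push_cast
  rfl

/-- The isometry of one qubit onto the singlet space of four qubits. A computational basis state
with two qubits in each of the states `0` and `1` has its equal qubits paired up in one of three
ways, and its amplitudes are those of the vector attached to this pairing. -/
noncomputable def singletIso : Matrix (Fin 4 → Fin 2) (Fin 2) ℂ := Matrix.of fun s k =>
  if s 0 = s 1 ∧ s 2 = s 3 ∧ s 0 ≠ s 2 then (pairVec 0 k : ℂ)
  else if s 0 = s 2 ∧ s 1 = s 3 ∧ s 0 ≠ s 1 then (pairVec 1 k : ℂ)
  else if s 0 = s 3 ∧ s 1 = s 2 ∧ s 0 ≠ s 1 then (pairVec 2 k : ℂ)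
  else 0

/-- `2 v vᵀ` for the logical vector `v` attached to a pairing: the compression to the singlet space
of the projector onto the basis states with that pairing. -/
noncomputable def pairProj (r : Fin 3) : Matrix (Fin 2) (Fin 2) ℂ :=
  Matrix.of fun k l => 2 * (pairVec r k : ℂ) * (pairVec r l : ℂ)

lemma singletIso_isometry : singletIsoᴴ * singletIso = 1 := by
  ext k l
  rw [Matrix.mul_apply, sum_four_qubits, Matrix.one_apply, ← sum_pairVec_mul_complex]
  simp [singletIso, Fin.sum_univ_two]
  ring

/-- Singlets have spin zero. -/
lemma spin_mul_singletIso (c : Fin 3) : spin c * singletIso = 0 := by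
  ext s k
  have h := sum_pairVec k
  have h' : (pairVec 0 k : ℂ) + pairVec 1 k + pairVec 2 k = 0 := by exact_mod_cast h
  rw [spin, Matrix.sum_mul, Matrix.sum_apply, eq_vec_four s]
  simp only [siteHom_mul_apply, Fin.sum_univ_four, Fin.sum_univ_two]
  generalize s 0 = s0
  generalize s 1 = s1
  generalize s 2 = s2
  generalize s 3 = s3
  fin_cases c <;> fin_cases s0 <;> fin_cases s1 <;> fin_cases s2 <;> fin_cases s3 <;>
    simp [singletIso, pauli, pauliX, pauliY, pauliZ] <;>
    first
    | linear_combination h'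
    | linear_combination Complex.I * h'
    | linear_combination -Complex.I * h'

lemma update_vec_four (a b c d u : Fin 2) :
    Function.update ![a, b, c, d] 0 u = ![u, b, c, d] ∧
    Function.update ![a, b, c, d] 1 u = ![a, u, c, d] ∧
    Function.update ![a, b, c, d] 2 u = ![a, b, u, d] ∧
    Function.update ![a, b, c, d] 3 u = ![a, b, c, u] := by
  refine ⟨?_, ?_, ?_, ?_⟩ <;> ext i <;> fin_cases i <;> rfl

/-- A state of four qubits without spin in two directions is a singlet. -/
lemma exists_eq_singletIso_mulVec {x : (Fin 4 → Fin 2) → ℂ} (h0 : spin 0 *ᵥ x = 0)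
    (h1 : spin 1 *ᵥ x = 0) : ∃ y, x = singletIso *ᵥ y := by
  have e0 : ∀ s, (spin 0 *ᵥ x) s = 0 := fun s => by rw [h0]; rfl
  have e1 : ∀ s, (spin 1 *ᵥ x) s = 0 := fun s => by rw [h1]; rfl
  simp only [spin, Fin.sum_univ_four, Matrix.add_mulVec, Pi.add_apply,
    siteHom_mulVec_apply, Fin.sum_univ_two] at e0 e1
  -- raising and lowering operators: flipping only the qubits in the state `0`, or only those in `1`
  have key : ∀ a b c d : Fin 2,
      (if a = 0 then x ![1, b, c, d] else 0) + (if b = 0 then x ![a, 1, c, d] else 0)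
        + (if c = 0 then x ![a, b, 1, d] else 0) + (if d = 0 then x ![a, b, c, 1] else 0) = 0 ∧
      (if a = 1 then x ![0, b, c, d] else 0) + (if b = 1 then x ![a, 0, c, d] else 0)
        + (if c = 1 then x ![a, b, 0, d] else 0) + (if d = 1 then x ![a, b, c, 0] else 0) = 0 := by
    intro a b c d
    have f0 := e0 ![a, b, c, d]
    have f1 := e1 ![a, b, c, d]
    simp only [update_vec_four] at f0 f1
    clear e0 e1 h0 h1
    have f2 := Complex.I_mul_I
    have two : ∀ a : Fin 2, a = 0 ∨ a = 1 := by decide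
    rcases two a with rfl | rfl <;> rcases two b with rfl | rfl <;>
      rcases two c with rfl | rfl <;> rcases two d with rfl | rfl <;>
      simp [pauli, pauliX, pauliY] at f0 f1 ⊢ <;> grind
  clear e0 e1 h0 h1
  simp only [Fin.forall_fin_two] at key
  simp at key
  have hs : ((√3 : ℝ) : ℂ) ≠ 0 := by simp
  refine ⟨![x ![0, 1, 0, 1] - x ![0, 1, 1, 0], √3 * x ![0, 0, 1, 1]], ?_⟩
  funext s
  have v0 : (((√3 : ℝ) : ℂ))⁻¹ * (√3 * x ![0, 0, 1, 1]) = x ![0, 0, 1, 1] := by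
    field_simp
  rw [eq_vec_four s]
  generalize s 0 = a
  generalize s 1 = b
  generalize s 2 = c
  generalize s 3 = d
  have two : ∀ a : Fin 2, a = 0 ∨ a = 1 := by decide
  rcases two a with rfl | rfl <;> rcases two b with rfl | rfl <;>
    rcases two c with rfl | rfl <;> rcases two d with rfl | rfl <;>
    simp [Matrix.mulVec, dotProduct, Fin.sum_univ_two, singletIso, pairVec] <;> grind

/-- The projector onto the complement of the singlet space is a left multiple of the components of
the spin in two directions. -/
lemma exists_one_sub_singletIso : ∃ A B : QOp 4,
    1 - singletIso * singletIsoᴴ = A * spin 0 + B * spin 1 := by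
  set B := ∑ i ∈ ({0, 1} : Finset (Fin 3)), (spin i)ᴴ * spin i + singletIso * singletIsoᴴ with hB
  have hpos : B.PosDef := by
    refine posDef_sum_conjTranspose_mul_self _ _ _ fun x hx hx' => ?_
    obtain ⟨y, rfl⟩ := exists_eq_singletIso_mulVec (hx 0 (by simp)) (hx 1 (by simp))
    rw [Matrix.mulVec_mulVec, singletIso_isometry, Matrix.one_mulVec] at hx'
    rw [hx', Matrix.mulVec_zero]
  have hdet : IsUnit B.det := (Matrix.isUnit_iff_isUnit_det _).mp hpos.isUnit
  have hBW : B * singletIso = singletIso := by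
    rw [hB, Matrix.add_mul, Matrix.sum_mul, Finset.sum_eq_zero, zero_add, Matrix.mul_assoc,
      singletIso_isometry, Matrix.mul_one]
    intro i _
    rw [Matrix.mul_assoc, spin_mul_singletIso, Matrix.mul_zero]
  have hBW' : B⁻¹ * singletIso = singletIso := by
    conv_lhs => rw [← hBW, ← Matrix.mul_assoc, nonsing_inv_mul _ hdet, Matrix.one_mul]
  refine ⟨B⁻¹ * spin 0, B⁻¹ * spin 1, ?_⟩
  have h1 : B⁻¹ * B = 1 := nonsing_inv_mul _ hdet
  have h2 : B = spin 0 * spin 0 + spin 1 * spin 1 + singletIso * singletIsoᴴ := by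
    rw [hB, Finset.sum_pair (by decide), spin_conjTranspose, spin_conjTranspose]
  rw [Matrix.mul_assoc, Matrix.mul_assoc, ← Matrix.mul_add, sub_eq_iff_eq_add]
  conv_rhs => rw [← hBW', Matrix.mul_assoc, ← Matrix.mul_add, hBW', ← h2, h1]

/-! ### Compressions to the singlet space -/

lemma singletIso_conjTranspose_mul_spin (c : Fin 3) : singletIsoᴴ * spin c = 0 := by
  have h := congrArg conjTranspose (spin_mul_singletIso c)
  rwa [conjTranspose_mul, spin_conjTranspose, conjTranspose_zero] at h

/-- Singlets are invariant under rotations. -/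
lemma compression_commutator_spin (c : Fin 3) (A : QOp 4) :
    singletIsoᴴ * ((spin c * A - A * spin c) * singletIso) = 0 := by
  rw [Matrix.sub_mul, Matrix.mul_sub, Matrix.mul_assoc A, spin_mul_singletIso, Matrix.mul_zero,
    Matrix.mul_zero, sub_zero, ← Matrix.mul_assoc, ← Matrix.mul_assoc,
    singletIso_conjTranspose_mul_spin, Matrix.zero_mul, Matrix.zero_mul]

/-- A Pauli matrix is a commutator of a spin component with another one, so it takes singlets out
of the singlet space. -/
lemma compression_pauli (i : Fin 4) (a : Fin 3) :
    singletIsoᴴ * (siteHom i (pauli a) * singletIso) = 0 := by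
  obtain ⟨c, k, hk, -, -, h⟩ := exists_pauli_rotation (show a ≠ a + 1 by fin_cases a <;> decide)
  have h1 := compression_commutator_spin (a + 1) (siteHom i (pauli c))
  rw [spin_commutator, add_sub_cancel_left, h, map_smul, Matrix.smul_mul, Matrix.mul_smul] at h1
  exact (smul_eq_zero.mp h1).resolve_left hk

/-- Products of different Pauli matrices are commutators with a spin component. -/
lemma compression_pauli_pauli_of_ne (i j : Fin 4) {a b : Fin 3} (hab : a ≠ b) :
    singletIsoᴴ * ((siteHom i (pauli a) * siteHom j (pauli b)) * singletIso) = 0 := by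
  obtain ⟨c, k, hk, -, -, h⟩ := exists_pauli_rotation hab
  have h1 := compression_commutator_spin b (siteHom i (pauli c) * siteHom j (pauli b))
  have h2 : spin b * (siteHom i (pauli c) * siteHom j (pauli b))
      - (siteHom i (pauli c) * siteHom j (pauli b)) * spin b
      = k • (siteHom i (pauli a) * siteHom j (pauli b)) := by
    rw [← Matrix.mul_assoc, spin_commutator, Matrix.add_mul, Matrix.mul_assoc _ (spin b),
      spin_commutator b j, h, sub_self, map_zero, add_zero, ← Matrix.mul_assoc, map_smul,
      Matrix.smul_mul, add_sub_cancel_left]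
  rw [h2, Matrix.smul_mul, Matrix.mul_smul] at h1
  exact (smul_eq_zero.mp h1).resolve_left hk

/-- Rotations take the products of equal Pauli matrices, compressed to singlets, into each other. -/
lemma compression_pauli_pauli_eq (i j : Fin 4) (a b : Fin 3) :
    singletIsoᴴ * ((siteHom i (pauli a) * siteHom j (pauli a)) * singletIso)
      = singletIsoᴴ * ((siteHom i (pauli b) * siteHom j (pauli b)) * singletIso) := by
  rcases eq_or_ne a b with rfl | hab
  · rfl
  obtain ⟨c, k, hk, h, h', -⟩ := exists_pauli_rotation hab
  have h1 := compression_commutator_spin c (siteHom i (pauli a) * siteHom j (pauli b))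
  have h2 : spin c * (siteHom i (pauli a) * siteHom j (pauli b))
      - (siteHom i (pauli a) * siteHom j (pauli b)) * spin c
      = k • (siteHom i (pauli b) * siteHom j (pauli b)
        - siteHom i (pauli a) * siteHom j (pauli a)) := by
    rw [← Matrix.mul_assoc, spin_commutator, Matrix.add_mul, Matrix.mul_assoc _ (spin c),
      spin_commutator c j, h, h', map_smul, map_smul, Matrix.mul_add, ← Matrix.mul_assoc,
      Matrix.smul_mul, Matrix.mul_smul, smul_sub, neg_smul]
    abel
  rw [h2, Matrix.smul_mul, Matrix.mul_smul, Matrix.sub_mul, Matrix.mul_sub] at h1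
  exact (sub_eq_zero.mp ((smul_eq_zero.mp h1).resolve_left hk)).symm

/-- The signs attached to a pairing of four qubits: `1` on the pair of the first qubit, and `-1` on
the other pair. -/
def pairSign : Fin 3 → Fin 4 → ℝ := ![![1, 1, -1, -1], ![1, -1, 1, -1], ![1, -1, -1, 1]]

/-- The sum of a Pauli matrix over four qubits with the signs attached to a pairing. -/
noncomputable def staggered (c r : Fin 3) : QOp 4 := ∑ i, pairSign r i • siteHom i (pauli c)

lemma staggered_conjTranspose (c r : Fin 3) : (staggered c r)ᴴ = staggered c r := by
  simp [staggered, conjTranspose_sum, siteHom_conjTranspose, pauli_conjTranspose]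

lemma compression_staggered (c r : Fin 3) :
    singletIsoᴴ * (staggered c r * singletIso) = 0 := by
  simp [staggered, Matrix.sum_mul, Matrix.mul_sum, compression_pauli]

lemma staggered_mul_staggered (a b r q : Fin 3) :
    singletIsoᴴ * ((staggered a r * staggered b q) * singletIso)
      = ∑ i, ∑ j, (pairSign r i * pairSign q j) •
        (singletIsoᴴ * ((siteHom i (pauli a) * siteHom j (pauli b)) * singletIso)) := by
  simp only [staggered, Matrix.sum_mul, Matrix.mul_sum, Matrix.smul_mul, Matrix.mul_smul,
    Finset.smul_sum, smul_smul]
  rw [Finset.sum_comm]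
  simp only [mul_comm]

lemma siteHom_pauliZ_mul_singletIso_apply (i : Fin 4) (s : Fin 4 → Fin 2) (k : Fin 2) :
    (siteHom i (pauli 2) * singletIso) s k = (if s i = 0 then 1 else -1) * singletIso s k := by
  rw [siteHom_mul_apply, Fin.sum_univ_two]
  have h : ∀ u, s i = u → Function.update s i u = s := fun u hu => by
    rw [← hu, Function.update_eq_self]
  rcases (show s i = 0 ∨ s i = 1 by generalize s i = u; fin_cases u <;> simp) with h1 | h1 <;>
    simp [h1, h _ h1, pauli, pauliZ]

/-- The signed sum of `Z` for one pairing vanishes on the basis states with the other pairings. -/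
lemma compression_staggered_Z (r q : Fin 3) :
    singletIsoᴴ * ((staggered 2 r * staggered 2 q) * singletIso)
      = if r = q then (16 : ℝ) • pairProj r else 0 := by
  have h1 : ∀ (r : Fin 3) (s : Fin 4 → Fin 2) (k : Fin 2), (staggered 2 r * singletIso) s k
      = (∑ i, (pairSign r i : ℂ) * (if s i = 0 then 1 else -1)) * singletIso s k := by
    intro r s k
    rw [staggered, Matrix.sum_mul, Matrix.sum_apply, Finset.sum_mul]
    refine Finset.sum_congr rfl fun i _ => ?_
    rw [Matrix.smul_mul, Matrix.smul_apply, siteHom_pauliZ_mul_singletIso_apply, mul_assoc]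
    rfl
  have h2 : singletIsoᴴ * ((staggered 2 r * staggered 2 q) * singletIso)
      = (staggered 2 r * singletIso)ᴴ * (staggered 2 q * singletIso) := by
    rw [conjTranspose_mul, staggered_conjTranspose]
    simp only [Matrix.mul_assoc]
  rw [h2]
  ext k l
  rw [Matrix.mul_apply, sum_four_qubits]
  simp only [conjTranspose_apply, h1, Fin.sum_univ_two, Fin.sum_univ_four]
  fin_cases r <;> fin_cases q <;> simp [singletIso, pairSign, pairProj] <;> ring

/-- Rotation invariance reduces products of staggered operators to those of the diagonal ones. -/
lemma compression_staggered_mul_staggered (a b r q : Fin 3) :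
    singletIsoᴴ * ((staggered a r * staggered b q) * singletIso)
      = if a = b ∧ r = q then (16 : ℝ) • pairProj r else 0 := by
  by_cases hab : a = b
  · subst hab
    rw [staggered_mul_staggered]
    simp only [compression_pauli_pauli_eq _ _ a 2]
    rw [← staggered_mul_staggered, compression_staggered_Z]
    simp
  · rw [staggered_mul_staggered]
    simp [compression_pauli_pauli_of_ne _ _ hab, hab]

/-- The exchange interaction of one pair within a block; the first qubit is paired with
`r.succ`. -/
lemma compression_pair (r c : Fin 3) :
    singletIsoᴴ * ((siteHom (0 : Fin 4) (pauli c) * siteHom (r.succ : Fin 4) (pauli c)) * singletIso)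
      = (2 : ℝ) • pairProj r - 1 := by
  rw [compression_pauli_pauli_eq _ _ c 2]
  have h2 : ∀ i j : Fin 4,
      singletIsoᴴ * ((siteHom i (pauli 2) * siteHom j (pauli 2)) * singletIso)
        = (siteHom i (pauli 2) * singletIso)ᴴ * (siteHom j (pauli 2) * singletIso) := by
    intro i j
    rw [conjTranspose_mul, siteHom_conjTranspose, pauli_conjTranspose]
    simp only [Matrix.mul_assoc]
  rw [h2, ← singletIso_isometry]
  ext k l
  rw [Matrix.sub_apply, Matrix.mul_apply, Matrix.mul_apply, sum_four_qubits, sum_four_qubits]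
  simp only [conjTranspose_apply, siteHom_pauliZ_mul_singletIso_apply, Fin.sum_univ_two]
  fin_cases r <;> simp [singletIso, pairProj] <;> ring

/-! ### Exchange interactions -/

lemma siteHom_mul_siteHom_apply {ι K : Type} [Fintype ι] [DecidableEq ι] [Fintype K]
    [DecidableEq K] {i j : ι} (h : i ≠ j) (A B : Matrix K K ℂ) (s t : ι → K) :
    (siteHom i A * siteHom j B) s t
      = if ∀ x, x ≠ i → x ≠ j → s x = t x then A (s i) (t i) * B (s j) (t j) else 0 := by
  rw [siteHom_mul_apply, Finset.sum_eq_single (t i)]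
  · simp only [siteHom_apply, onSite, Matrix.of_apply, Function.update_of_ne h.symm]
    have h1 : (∀ x, x ≠ j → Function.update s i (t i) x = t x)
        ↔ ∀ x, x ≠ i → x ≠ j → s x = t x := by
      refine forall_congr' fun x => ?_
      by_cases hx : x = i
      · subst hx; simp
      · simp [hx]
    simp only [h1, mul_ite, mul_zero]
  · intro u _ hu
    simp only [siteHom_apply, onSite, Matrix.of_apply]
    rw [if_neg, mul_zero]
    intro h1
    have := h1 i h
    rw [Function.update_self] at this
    exact hu this
  · simp

/-- The interaction `∑ c ∈ D, σ_c ⊗ σ_c` of the qubits `i` and `j`. The Heisenberg interaction has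
`D = {X, Y, Z}`, the XY interaction has `D = {X, Y}`. -/
noncomputable def exchange (D : Finset (Fin 3)) {m : ℕ} (i j : Fin m) : QOp m :=
  ∑ c ∈ D, siteHom i (pauli c) * siteHom j (pauli c)

lemma heisenberg_eq_exchange : heisenberg = exchange Finset.univ 0 1 := by
  rw [exchange, Fin.sum_univ_three]; rfl

lemma xyInteraction_eq_exchange : xyInteraction = exchange {0, 1} 0 1 := by
  rw [exchange, Finset.sum_pair (by decide)]; rfl

lemma placed_exchange (D : Finset (Fin 3)) {m : ℕ} {f : Fin 2 → Fin m}
    (hf : Function.Injective f) : placed f (exchange D 0 1) = exchange D (f 0) (f 1) := by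
  have h01 : f 0 ≠ f 1 := hf.ne (by decide)
  ext s t
  simp only [placed, exchange, Matrix.of_apply, Matrix.sum_apply, siteHom_mul_siteHom_apply h01,
    siteHom_mul_siteHom_apply (show (0 : Fin 2) ≠ 1 by decide), Fin.forall_fin_two]
  simp only [ne_comm (a := f _), Function.comp_apply, not_true_eq_false, ne_eq, false_imp_iff,
    zero_ne_one, one_ne_zero, not_false_eq_true, and_self, implies_true, if_true, and_imp]
  split_ifs with h
  · rfl
  · simp

lemma injective_pair {m : ℕ} {i j : Fin m} (h : i ≠ j) : Function.Injective ![i, j] := by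
  intro a b hab
  fin_cases a <;> fin_cases b <;> simp_all

lemma exchange_mem_interactionFamily (D : Finset (Fin 3)) {m : ℕ} {i j : Fin m} (h : i ≠ j) :
    exchange D i j ∈ interactionFamily {exchange D (0 : Fin 2) 1} m := by
  refine Submodule.subset_span (Or.inr ⟨_, rfl, ![i, j], injective_pair h, ?_⟩)
  rw [placed_exchange D (injective_pair h)]; rfl

/-- The Hamiltonian of one block of four qubits: half the sum of the squared spin components. It is
the interaction on the complete graph, shifted to have ground energy `0`. -/
noncomputable def blockHam (D : Finset (Fin 3)) : QOp 4 :=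
  (1 / 2 : ℝ) • ∑ c ∈ D, spin c * spin c

lemma completeGraph4_eq_sum (D : Finset (Fin 3)) :
    completeGraph4 (exchange D 0 1) = ∑ i : Fin 4, ∑ j ∈ Finset.Ioi i, exchange D i j := by
  refine Finset.sum_congr rfl fun i _ => Finset.sum_congr rfl fun j hj => ?_
  rw [placed_exchange D (injective_pair (Finset.mem_Ioi.mp hj).ne)]
  rfl

lemma completeGraph4_exchange (D : Finset (Fin 3)) :
    completeGraph4 (exchange D 0 1) = blockHam D - (2 * D.card : ℝ) • (1 : QOp 4) := by
  have h2 : ∀ c, spin c * spin c = (4 : ℝ) • (1 : QOp 4)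
      + (2 : ℝ) • ∑ i : Fin 4, ∑ j ∈ Finset.Ioi i, siteHom i (pauli c) * siteHom j (pauli c) := by
    intro c
    have hsq : ∀ i : Fin 4, siteHom i (pauli c) * siteHom i (pauli c) = (1 : QOp 4) := fun i => by
      rw [← map_mul, pauli_mul_self, map_one]
    rw [show (4 : ℝ) • (1 : QOp 4) = 1 + 1 + 1 + 1 by module]
    have i0 : Finset.Ioi (0 : Fin 4) = {1, 2, 3} := by decide
    have i1 : Finset.Ioi (1 : Fin 4) = {2, 3} := by decide
    have i2 : Finset.Ioi (2 : Fin 4) = {3} := by decide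
    have i3 : Finset.Ioi (3 : Fin 4) = ∅ := by decide
    simp only [spin, Fin.sum_univ_four, Matrix.add_mul, Matrix.mul_add, hsq, i0, i1, i2, i3]
    rw [siteHom_comm (show (1 : Fin 4) ≠ 0 by decide), siteHom_comm (show (2 : Fin 4) ≠ 0 by decide),
      siteHom_comm (show (3 : Fin 4) ≠ 0 by decide), siteHom_comm (show (2 : Fin 4) ≠ 1 by decide),
      siteHom_comm (show (3 : Fin 4) ≠ 1 by decide), siteHom_comm (show (3 : Fin 4) ≠ 2 by decide)]
    simp
    module
  rw [completeGraph4_eq_sum, blockHam]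
  simp only [h2, Finset.sum_add_distrib, Finset.sum_const, ← Finset.smul_sum, exchange]
  have h3 : ∑ i : Fin 4, ∑ j ∈ Finset.Ioi i, ∑ c ∈ D,
        (siteHom i (pauli c) * siteHom j (pauli c) : QOp 4)
      = ∑ c ∈ D, ∑ i : Fin 4, ∑ j ∈ Finset.Ioi i, siteHom i (pauli c) * siteHom j (pauli c) := by
    rw [Finset.sum_comm (s := D)]
    exact Finset.sum_congr rfl fun i _ => Finset.sum_comm
  rw [h3, ← Nat.cast_smul_eq_nsmul ℝ]
  module

lemma blockHam_mul_singletIso (D : Finset (Fin 3)) : blockHam D * singletIso = 0 := by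
  simp [blockHam, Matrix.sum_mul, Matrix.mul_assoc, spin_mul_singletIso]

/-- A Pauli matrix `σ_b` with `b ∈ D` excites a singlet to spin one, and to an eigenstate of the
block Hamiltonian. -/
lemma blockHam_mul_pauli {D : Finset (Fin 3)} {b : Fin 3} (hb : b ∈ D) (i : Fin 4) :
    blockHam D * (siteHom i (pauli b) * singletIso)
      = (2 * (D.card - 1) : ℝ) • (siteHom i (pauli b) * singletIso) := by
  have h1 : ∀ (c : Fin 3) (A : Matrix (Fin 2) (Fin 2) ℂ), spin c * (siteHom i A * singletIso)
      = siteHom i (pauli c * A - A * pauli c) * singletIso := by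
    intro c A
    rw [← Matrix.mul_assoc, spin_commutator, Matrix.add_mul, Matrix.mul_assoc, spin_mul_singletIso,
      Matrix.mul_zero, zero_add]
  have h2 : ∀ c, spin c * spin c * (siteHom i (pauli b) * singletIso)
      = (if c = b then 0 else 4 : ℝ) • (siteHom i (pauli b) * singletIso) := by
    intro c
    rw [Matrix.mul_assoc, h1, h1, pauli_double_commutator, map_smul, Matrix.smul_mul]
    split_ifs <;> ext s t <;> simp
  rw [blockHam, Matrix.smul_mul, Matrix.sum_mul, Finset.sum_congr rfl fun c _ => h2 c,
    ← Finset.sum_smul, smul_smul]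
  congr 1
  have h3 : ∀ c : Fin 3, (if c = b then 0 else 4 : ℝ) = 4 - if c = b then 4 else 0 := by
    intro c; split_ifs <;> simp
  simp only [h3, Finset.sum_sub_distrib, Finset.sum_const, Finset.sum_ite_eq', hb, if_true,
    nsmul_eq_mul]
  ring

lemma blockHam_mul_staggered {D : Finset (Fin 3)} {b : Fin 3} (hb : b ∈ D) (r : Fin 3) :
    blockHam D * (staggered b r * singletIso)
      = (2 * (D.card - 1) : ℝ) • (staggered b r * singletIso) := by
  simp only [staggered, Matrix.sum_mul, Matrix.mul_sum, Matrix.smul_mul, Matrix.mul_smul,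
    blockHam_mul_pauli hb, Finset.smul_sum]
  refine Finset.sum_congr rfl fun i _ => ?_
  rw [smul_comm]

lemma re_inner_blockHam (D : Finset (Fin 3)) (x : EuclideanSpace ℂ (Fin 4 → Fin 2)) :
    (inner ℂ x (toEuclideanLin (blockHam D) x)).re
      = 1 / 2 * ∑ c ∈ D, ‖toEuclideanLin (spin c) x‖ ^ 2 := by
  rw [blockHam, toEuclideanLin_real_smul, inner_smul_right, Complex.re_ofReal_mul, map_sum,
    LinearMap.sum_apply, inner_sum, Complex.re_sum]
  congr 1
  refine Finset.sum_congr rfl fun c _ => ?_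
  rw [← re_inner_conjTranspose_mul_self, spin_conjTranspose]

/-- The kernel of the block Hamiltonian is the singlet space. -/
lemma mem_range_singletIso_of_blockHam {D : Finset (Fin 3)} (h0 : 0 ∈ D) (h1 : 1 ∈ D)
    {x : EuclideanSpace ℂ (Fin 4 → Fin 2)} (hx : toEuclideanLin (blockHam D) x = 0) :
    x ∈ LinearMap.range (toEuclideanLin singletIso) := by
  have h := re_inner_blockHam D x
  rw [hx, inner_zero_right, Complex.zero_re, eq_comm, mul_eq_zero_iff_left (by norm_num),
    Finset.sum_eq_zero_iff_of_nonneg (fun _ _ => by positivity)] at h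
  have h' : ∀ c ∈ D, spin c *ᵥ x.ofLp = 0 := by
    intro c hc
    have h2 := h c hc
    rw [sq_eq_zero_iff, norm_eq_zero] at h2
    rw [toLpLin_apply] at h2
    exact congrArg WithLp.ofLp h2
  obtain ⟨y, hy⟩ := exists_eq_singletIso_mulVec (h' 0 h0) (h' 1 h1)
  refine ⟨WithLp.toLp 2 y, ?_⟩
  rw [toLpLin_apply]
  exact congrArg (WithLp.toLp 2) hy.symm

/-- The ground space of the complete graph on four qubits is the singlet space. -/
theorem groundSpace_completeGraph4 {D : Finset (Fin 3)} (h0 : 0 ∈ D) (h1 : 1 ∈ D) :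
    groundSpace (completeGraph4 (exchange D 0 1)) = LinearMap.range (toEuclideanLin singletIso) := by
  set C := completeGraph4 (exchange D 0 1) with hC
  have hCx : ∀ x, toEuclideanLin C x
      = toEuclideanLin (blockHam D) x - ((2 * D.card : ℝ) : ℂ) • x := by
    intro x
    rw [hC, completeGraph4_exchange, map_sub, LinearMap.sub_apply, toEuclideanLin_real_smul,
      toEuclideanLin_one_apply]
  have hmem : ∀ x, x ∈ Module.End.eigenspace (toEuclideanLin C) ((-(2 * D.card) : ℝ) : ℂ)
      ↔ x ∈ LinearMap.range (toEuclideanLin singletIso) := by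
    intro x
    rw [Module.End.mem_eigenspace_iff, hCx, Complex.ofReal_neg, neg_smul, sub_eq_add_neg,
      add_eq_right]
    refine ⟨mem_range_singletIso_of_blockHam h0 h1, ?_⟩
    rintro ⟨y, rfl⟩
    rw [← toEuclideanLin_mul_apply, blockHam_mul_singletIso, map_zero, LinearMap.zero_apply]
  have hleast : IsLeast {lam : ℝ | Module.End.HasEigenvalue (toEuclideanLin C) (lam : ℂ)}
      (-(2 * D.card)) := by
    refine ⟨?_, fun lam hlam => ?_⟩
    · obtain ⟨y, hy⟩ := exists_ne (0 : EuclideanSpace ℂ (Fin 2))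
      refine Module.End.hasEigenvalue_of_hasEigenvector
        (x := toEuclideanLin singletIso y) ⟨(hmem _).mpr ⟨y, rfl⟩, fun h => hy ?_⟩
      rw [← toEuclideanLin_one_apply y, ← singletIso_isometry, toEuclideanLin_mul_apply, h,
        map_zero]
    · obtain ⟨x, hx, hx0⟩ := hlam.exists_hasEigenvector
      rw [Module.End.mem_eigenspace_iff, hCx, sub_eq_iff_eq_add, ← add_smul,
        ← Complex.ofReal_add] at hx
      have h := re_inner_blockHam D x
      rw [hx, inner_smul_right, Complex.re_ofReal_mul,
        show (inner ℂ x x).re = ‖x‖ ^ 2 from inner_self_eq_norm_sq (𝕜 := ℂ) x] at h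
      have hpos : 0 ≤ 1 / 2 * ∑ c ∈ D, ‖toEuclideanLin (spin c) x‖ ^ 2 := by positivity
      rw [← h] at hpos
      have := nonneg_of_mul_nonneg_left hpos (by positivity : 0 < ‖x‖ ^ 2)
      linarith
  rw [groundSpace, hleast.csInf_eq]
  ext x
  exact hmem x

lemma finrank_range_singletIso :
    Module.finrank ℂ (LinearMap.range (toEuclideanLin singletIso)) = 2 := by
  rw [LinearMap.finrank_range_of_inj, finrank_euclideanSpace, Fintype.card_fin]
  intro x y h
  rw [← toEuclideanLin_one_apply x, ← toEuclideanLin_one_apply y, ← singletIso_isometry,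
    toEuclideanLin_mul_apply, h, toEuclideanLin_mul_apply]

/-! ### Many blocks of four qubits -/

lemma siteHom_real_smul {ι K : Type} [Fintype ι] [DecidableEq ι] [Fintype K] [DecidableEq K]
    (j : ι) (c : ℝ) (A : Matrix K K ℂ) : siteHom j (c • A) = c • siteHom j A := by
  ext s t
  simp only [siteHom_apply, onSite, Matrix.of_apply, Matrix.smul_apply]
  split_ifs <;> simp

section Blocks

variable {n : ℕ} (D : Finset (Fin 3))

/-- Operators on `n` blocks of four qubits. -/
abbrev BlockOp (n : ℕ) : Type := Matrix (Fin n → Fin 4 → Fin 2) (Fin n → Fin 4 → Fin 2) ℂ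

/-- The isometry `W ⊗ ⋯ ⊗ W` of `n` qubits onto the singlets of `n` blocks. -/
noncomputable def blockIso (n : ℕ) : Matrix (Fin n → Fin 4 → Fin 2) (Fin n → Fin 2) ℂ :=
  tpow (Fin n) singletIso

lemma blockIso_isometry : (blockIso n)ᴴ * blockIso n = 1 := tpow_isometry singletIso_isometry

/-- The unperturbed Hamiltonian: every block has the interaction on its complete graph. -/
noncomputable def freeHam (n : ℕ) : BlockOp n := ∑ j, siteHom j (blockHam D)

/-- The interaction of the blocks `i` and `j` with weights `w` for the pairs of pairings. -/
noncomputable def link (w : Fin 3 → Fin 3 → ℝ) (i j : Fin n) : BlockOp n :=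
  ∑ r, ∑ q, w r q • ∑ c ∈ D, siteHom i (staggered c r) * siteHom j (staggered c q)

/-- The interaction of all pairs of blocks. -/
noncomputable def linkHam (w : Fin n → Fin n → Fin 3 → Fin 3 → ℝ) : BlockOp n :=
  ∑ i, ∑ j ∈ Finset.Iio i, link D (w i j) i j

/-- The interaction within the blocks, with weights `d` for the pairings, and a constant. -/
noncomputable def fieldHam (d : Fin n → Fin 3 → ℝ) (c : ℝ) : BlockOp n :=
  ∑ k, ∑ r : Fin 3, d k r • siteHom k (exchange D (0 : Fin 4) r.succ) + c • 1

lemma freeHam_mul_blockIso : freeHam D n * blockIso n = 0 := by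
  rw [freeHam, Matrix.sum_mul]
  exact Finset.sum_eq_zero fun j _ => siteHom_mul_tpow_eq_zero (blockHam_mul_singletIso D)

lemma blockHam_isHermitian : (blockHam D).IsHermitian := by
  simp [IsHermitian, blockHam, conjTranspose_sum, spin_conjTranspose]

lemma freeHam_isHermitian : (freeHam D n).IsHermitian := by
  simp [IsHermitian, freeHam, conjTranspose_sum, siteHom_conjTranspose,
    (blockHam_isHermitian D).eq]

lemma siteHom_mul_isHermitian {i j : Fin n} (h : i ≠ j) {A B : QOp 4} (hA : Aᴴ = A)
    (hB : Bᴴ = B) : (siteHom i A * siteHom j B)ᴴ = siteHom i A * siteHom j B := by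
  rw [conjTranspose_mul, siteHom_conjTranspose, siteHom_conjTranspose, hA, hB,
    siteHom_comm h.symm]

lemma linkHam_isHermitian (w : Fin n → Fin n → Fin 3 → Fin 3 → ℝ) :
    (linkHam D w).IsHermitian := by
  simp only [IsHermitian, linkHam, conjTranspose_sum, link, conjTranspose_smul, star_trivial]
  refine Finset.sum_congr rfl fun i _ => Finset.sum_congr rfl fun j hj => ?_
  simp only [siteHom_mul_isHermitian (Finset.mem_Iio.mp hj).ne' (staggered_conjTranspose _ _)
    (staggered_conjTranspose _ _)]

lemma exchange_isHermitian {m : ℕ} {i j : Fin m} (h : i ≠ j) :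
    (exchange D i j)ᴴ = exchange D i j := by
  rw [exchange, conjTranspose_sum]
  refine Finset.sum_congr rfl fun c _ => ?_
  rw [conjTranspose_mul, siteHom_conjTranspose, siteHom_conjTranspose, pauli_conjTranspose,
    siteHom_comm h.symm]

lemma fieldHam_isHermitian (d : Fin n → Fin 3 → ℝ) (c : ℝ) : (fieldHam D d c).IsHermitian := by
  simp [IsHermitian, fieldHam, conjTranspose_sum, siteHom_conjTranspose,
    exchange_isHermitian D (Fin.succ_ne_zero _).symm]

/-- The kernel of the unperturbed Hamiltonian is the range of `W ⊗ ⋯ ⊗ W`: adding the projector onto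
the latter makes it positive definite. -/
lemma posDef_freeHam_add (h0 : 0 ∈ D) (h1 : 1 ∈ D) :
    (freeHam D n + blockIso n * (blockIso n)ᴴ).PosDef := by
  have hs : (√(1 / 2 : ℝ)) * √(1 / 2 : ℝ) = 1 / 2 := Real.mul_self_sqrt (by norm_num)
  have hsum : freeHam D n = ∑ p ∈ (Finset.univ : Finset (Fin n)) ×ˢ D,
      (√(1 / 2 : ℝ) • siteHom p.1 (spin p.2))ᴴ * (√(1 / 2 : ℝ) • siteHom p.1 (spin p.2)) := by
    rw [Finset.sum_product, freeHam]
    refine Finset.sum_congr rfl fun j _ => ?_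
    rw [blockHam, siteHom_real_smul, map_sum, Finset.smul_sum]
    refine Finset.sum_congr rfl fun c _ => ?_
    rw [conjTranspose_smul, star_trivial, siteHom_conjTranspose, spin_conjTranspose,
      Matrix.smul_mul, Matrix.mul_smul, smul_smul, hs, map_mul]
  rw [hsum]
  refine posDef_sum_conjTranspose_mul_self _ _ _ fun x hx hx' => ?_
  have hspin : ∀ j : Fin n, ∀ c ∈ D, siteHom j (spin c) *ᵥ x = 0 := by
    intro j c hc
    have h := hx (j, c) (by simp [hc])
    rw [Matrix.smul_mulVec] at h
    exact (smul_eq_zero.mp h).resolve_left (by positivity)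
  -- vanishing spin on every block makes `x` invariant under the singlet projector of every block
  obtain ⟨A, B, hAB⟩ := exists_one_sub_singletIso
  have hfix : ∀ j : Fin n, siteHom j (singletIso * singletIsoᴴ) *ᵥ x = x := by
    intro j
    have h : singletIso * singletIsoᴴ = 1 - (A * spin 0 + B * spin 1) := by rw [← hAB]; abel
    rw [h, map_sub, map_one, map_add, map_mul, map_mul, Matrix.sub_mulVec, Matrix.add_mulVec,
      ← Matrix.mulVec_mulVec, ← Matrix.mulVec_mulVec, hspin j 0 h0, hspin j 1 h1]
    simp
  have hall := tpow_mulVec_eq_self hfix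
  have hmul : tpow (Fin n) (singletIso * singletIsoᴴ) = blockIso n * (blockIso n)ᴴ := by
    rw [blockIso, tpow, tpow, tens_conjTranspose, tens_mul]
  rw [hmul, ← Matrix.mulVec_mulVec, hx', Matrix.mulVec_zero] at hall
  exact hall.symm

/-- Two excited blocks have twice the excitation energy of one block. -/
lemma freeHam_mul_pair {i j : Fin n} (hij : i ≠ j) {g : ℝ} {A B : QOp 4}
    (hA : blockHam D * (A * singletIso) = g • (A * singletIso))
    (hB : blockHam D * (B * singletIso) = g • (B * singletIso)) :
    freeHam D n * (siteHom i A * siteHom j B * blockIso n)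
      = (2 * g) • (siteHom i A * siteHom j B * blockIso n) := by
  have hex : ∀ (j : Fin n) {A : QOp 4}, blockHam D * (A * singletIso) = g • (A * singletIso) →
      siteHom j (blockHam D) * (siteHom j A * blockIso n) = g • (siteHom j A * blockIso n) := by
    intro j A h
    rw [← Matrix.mul_assoc, ← map_mul, ← Matrix.smul_mul, ← siteHom_real_smul]
    exact siteHom_mul_tpow_congr (by rw [Matrix.mul_assoc, h, Matrix.smul_mul])
  rw [freeHam, Matrix.sum_mul, Finset.sum_eq_add i j hij]
  · have e1 : siteHom i (blockHam D) * (siteHom i A * siteHom j B * blockIso n)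
        = g • (siteHom i A * siteHom j B * blockIso n) := by
      rw [siteHom_comm hij, Matrix.mul_assoc (siteHom j B), ← Matrix.mul_assoc, siteHom_comm hij,
        Matrix.mul_assoc, hex i hA, Matrix.mul_smul]
    have e2 : siteHom j (blockHam D) * (siteHom i A * siteHom j B * blockIso n)
        = g • (siteHom i A * siteHom j B * blockIso n) := by
      rw [Matrix.mul_assoc (siteHom i A), ← Matrix.mul_assoc, siteHom_comm hij.symm,
        Matrix.mul_assoc, hex j hB, Matrix.mul_smul]
    rw [e1, e2, two_mul, add_smul]
  · rintro k - ⟨hki, hkj⟩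
    rw [← Matrix.mul_assoc, ← Matrix.mul_assoc, siteHom_comm hki, Matrix.mul_assoc (siteHom i A),
      siteHom_comm hkj, Matrix.mul_assoc, Matrix.mul_assoc, blockIso,
      siteHom_mul_tpow_eq_zero (blockHam_mul_singletIso D), Matrix.mul_zero, Matrix.mul_zero]
  · simp
  · simp

lemma freeHam_mul_linkHam (w : Fin n → Fin n → Fin 3 → Fin 3 → ℝ) :
    freeHam D n * (linkHam D w * blockIso n)
      = (2 * (2 * (D.card - 1)) : ℝ) • (linkHam D w * blockIso n) := by
  simp only [linkHam, link, Matrix.sum_mul, Matrix.mul_sum, Matrix.smul_mul, Matrix.mul_smul,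
    Finset.smul_sum]
  refine Finset.sum_congr rfl fun i _ => Finset.sum_congr rfl fun j hj =>
    Finset.sum_congr rfl fun r _ => Finset.sum_congr rfl fun q _ =>
      Finset.sum_congr rfl fun c hc => ?_
  rw [freeHam_mul_pair D (Finset.mem_Iio.mp hj).ne' (blockHam_mul_staggered hc r)
    (blockHam_mul_staggered hc q), smul_comm]

/-- Virtual excitations by two different pairs of blocks do not contribute to second order: some
block is excited by one of the two links only. -/
lemma compression_link_link_eq_zero (w w' : Fin 3 → Fin 3 → ℝ) {i j k l : Fin n} (hij : j < i)
    (hkl : l < k) (h : ¬ (i = k ∧ j = l)) :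
    (blockIso n)ᴴ * (link D w i j * (link D w' k l * blockIso n)) = 0 := by
  have key : ∀ a b r q r' q', (blockIso n)ᴴ * (siteHom i (staggered a r) * siteHom j (staggered a q)
      * (siteHom k (staggered b r') * siteHom l (staggered b q')) * blockIso n) = 0 := by
    intro a b r q r' q'
    by_cases hi : i = k ∨ i = l
    · have hjk : j ≠ k := by
        rintro rfl
        rcases hi with rfl | rfl
        · exact lt_irrefl _ hij
        · exact lt_asymm hij hkl
      have hjl : j ≠ l := by
        rintro rfl
        rcases hi with rfl | rfl
        · exact h ⟨rfl, rfl⟩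
        · exact lt_irrefl _ hij
      rw [siteHom_comm hij.ne']
      exact tpow_sandwich_four_eq_zero hij.ne hjk hjl (compression_staggered a q) _ _ _
    · push Not at hi
      exact tpow_sandwich_four_eq_zero hij.ne' hi.1 hi.2 (compression_staggered a r) _ _ _
  simp only [link, Matrix.sum_mul, Matrix.mul_sum, Matrix.smul_mul, Matrix.mul_smul]
  simp only [← Matrix.mul_assoc] at key ⊢
  simp [key]

/-- The second-order contribution of one pair of blocks. -/
lemma compression_link_link (w : Fin 3 → Fin 3 → ℝ) {i j : Fin n} (hij : i ≠ j) :
    (blockIso n)ᴴ * (link D w i j * (link D w i j * blockIso n))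
      = (256 * D.card : ℝ) • ∑ r, ∑ q, (w r q ^ 2) •
        (siteHom i (pairProj r) * siteHom j (pairProj q)) := by
  have key : ∀ a b r q r' q',
      (blockIso n)ᴴ * (siteHom i (staggered a r) * siteHom j (staggered a q)
        * (siteHom i (staggered b r') * siteHom j (staggered b q') * blockIso n))
      = if a = b ∧ r = r' ∧ q = q'
        then (256 : ℝ) • (siteHom i (pairProj r) * siteHom j (pairProj q)) else 0 := by
    intro a b r q r' q'
    have h1 : siteHom i (staggered a r) * siteHom j (staggered a q)
        * (siteHom i (staggered b r') * siteHom j (staggered b q') * blockIso n)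
        = siteHom i (staggered a r * staggered b r') * siteHom j (staggered a q * staggered b q')
          * blockIso n := by
      rw [map_mul, map_mul]
      simp only [Matrix.mul_assoc]
      rw [← Matrix.mul_assoc (siteHom j (staggered a q)), siteHom_comm hij.symm]
      simp only [Matrix.mul_assoc]
    rw [h1, blockIso, tpow_sandwich_two singletIso_isometry hij,
      compression_staggered_mul_staggered, compression_staggered_mul_staggered]
    by_cases hab : a = b <;> by_cases hr : r = r' <;> by_cases hq : q = q' <;>
      simp [hab, hr, hq, siteHom_real_smul, smul_smul]
    norm_num
  simp only [link, Matrix.sum_mul, Matrix.mul_sum, Matrix.smul_mul, Matrix.mul_smul, key,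
    Finset.smul_sum]
  refine Finset.sum_congr rfl fun r _ => Finset.sum_congr rfl fun q _ => ?_
  have hin : ∀ a ∈ D, ∑ r', ∑ q', ∑ b ∈ D, w r q • w r' q' • (if b = a ∧ r' = r ∧ q' = q
        then (256 : ℝ) • (siteHom i (pairProj r') * siteHom j (pairProj q')) else 0)
      = (w r q * (w r q * 256)) • (siteHom i (pairProj r) * siteHom j (pairProj q)) := by
    intro a ha
    simp [ite_and, ha, smul_smul]
  rw [Finset.sum_congr rfl hin, Finset.sum_const, ← Nat.cast_smul_eq_nsmul ℝ, smul_smul, smul_smul]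
  congr 1
  ring

/-- The second-order contribution of the links. -/
lemma compression_linkHam_linkHam (w : Fin n → Fin n → Fin 3 → Fin 3 → ℝ) :
    (blockIso n)ᴴ * (linkHam D w * (linkHam D w * blockIso n))
      = (256 * D.card : ℝ) • ∑ i, ∑ j ∈ Finset.Iio i, ∑ r, ∑ q, (w i j r q ^ 2) •
        (siteHom i (pairProj r) * siteHom j (pairProj q)) := by
  have hsum : linkHam D w * blockIso n
      = ∑ k, ∑ l ∈ Finset.Iio k, link D (w k l) k l * blockIso n := by
    simp only [linkHam, Matrix.sum_mul]
  have hone : ∀ i, ∀ j ∈ Finset.Iio i,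
      (blockIso n)ᴴ * (link D (w i j) i j * (linkHam D w * blockIso n))
        = (blockIso n)ᴴ * (link D (w i j) i j * (link D (w i j) i j * blockIso n)) := by
    intro i j hj
    have hj' := Finset.mem_Iio.mp hj
    simp only [hsum, Matrix.mul_sum]
    rw [Finset.sum_eq_single i, Finset.sum_eq_single j]
    · exact fun l hl hlj => compression_link_link_eq_zero D _ _ hj' (Finset.mem_Iio.mp hl)
        fun h => hlj h.2.symm
    · exact fun h => absurd hj h
    · exact fun k _ hki => Finset.sum_eq_zero fun l hl =>
        compression_link_link_eq_zero D _ _ hj' (Finset.mem_Iio.mp hl) fun h => hki h.1.symm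
    · simp
  generalize hY : linkHam D w * blockIso n = Y at hone
  rw [linkHam, Matrix.sum_mul, Matrix.mul_sum, Finset.smul_sum]
  refine Finset.sum_congr rfl fun i _ => ?_
  rw [Matrix.sum_mul, Matrix.mul_sum, Finset.smul_sum]
  refine Finset.sum_congr rfl fun j hj => ?_
  rw [hone i j hj, compression_link_link D _ (Finset.mem_Iio.mp hj).ne']

/-- The first-order contribution of the interactions within the blocks. -/
lemma compression_fieldHam (d : Fin n → Fin 3 → ℝ) (c : ℝ) :
    (blockIso n)ᴴ * (fieldHam D d c * blockIso n)
      = ∑ k, ∑ r, (D.card * d k r) • ((2 : ℝ) • siteHom k (pairProj r) - 1) + c • 1 := by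
  simp only [fieldHam, Matrix.add_mul, Matrix.mul_add, Matrix.sum_mul, Matrix.mul_sum,
    Matrix.smul_mul, Matrix.mul_smul, Matrix.one_mul, blockIso_isometry]
  congr 1
  refine Finset.sum_congr rfl fun k _ => Finset.sum_congr rfl fun r _ => ?_
  rw [blockIso, tpow_sandwich_one singletIso_isometry, exchange, Matrix.sum_mul, Matrix.mul_sum,
    Finset.sum_congr rfl fun a _ => compression_pair r a, Finset.sum_const, map_nsmul, map_sub,
    map_one, siteHom_real_smul, ← Nat.cast_smul_eq_nsmul ℝ, smul_smul, mul_comm]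

end Blocks

/-! ### Reaching every target Hamiltonian -/

lemma sum_pairProj : ∑ r, pairProj r = 1 := by
  ext k l
  rw [Fin.sum_univ_three, Matrix.one_apply, ← sum_pairVec_mul_complex]
  simp only [pairProj, Matrix.add_apply, Matrix.of_apply]
  ring

lemma pauliX_eq_pairProj : pauliX = √3 • (pairProj 2 - pairProj 1) := by
  have h0 : (√3 : ℂ) ≠ 0 := by simp
  ext k l
  fin_cases k <;> fin_cases l <;> simp [pauliX, pairProj, pairVec] <;> field_simp <;> norm_num

lemma pauliZ_eq_pairProj : pauliZ = 1 - (3 : ℝ) • pairProj 0 := by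
  have h : (√3 : ℂ) ^ 2 = 3 := by exact_mod_cast Real.sq_sqrt (by norm_num : (0 : ℝ) ≤ 3)
  have h0 : (√3 : ℂ) ≠ 0 := by simp
  ext k l
  fin_cases k <;> fin_cases l <;> simp [pauliZ, pairProj, pairVec]
  field_simp
  simp [h]
  norm_num

/-- The coefficients of `X` and `Z` in terms of the projectors attached to the pairings. -/
noncomputable def xzCoeff : Fin 2 → Fin 3 → ℝ := ![![0, -√3, √3], ![-2, 1, 1]]

lemma pauliXZ_eq_sum (p : Fin 2) : pauliXZ p = ∑ r, xzCoeff p r • pairProj r := by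
  rw [Fin.sum_univ_three]
  fin_cases p
  · change pauliX = (0 : ℝ) • pairProj 0 + (-√3) • pairProj 1 + √3 • pairProj 2
    rw [pauliX_eq_pairProj]
    module
  · change pauliZ = (-2 : ℝ) • pairProj 0 + (1 : ℝ) • pairProj 1 + (1 : ℝ) • pairProj 2
    rw [pauliZ_eq_pairProj, ← sum_pairProj, Fin.sum_univ_three]
    module

/-- A two-qubit `X`-`Z` interaction is, up to a constant, a combination with coefficients `-u w²`
of products of the projectors attached to the pairings, because these add up to `1`. -/
lemma exists_link_weights {n : ℕ} (i j : Fin n) (α : Fin 2 → Fin 2 → ℝ) {u : ℝ} (hu : 0 < u) :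
    ∃ (w : Fin 3 → Fin 3 → ℝ) (κ : ℝ),
      ∑ p, ∑ q, α p q • (onQubit i (pauliXZ p) * onQubit j (pauliXZ q))
        = κ • 1 - u • ∑ r, ∑ q, (w r q ^ 2) • (siteHom i (pairProj r) * siteHom j (pairProj q)) := by
  set c : Fin 3 → Fin 3 → ℝ := fun r s => ∑ p, ∑ q, α p q * xzCoeff p r * xzCoeff q s with hc
  -- any upper bound of the coefficients will do
  set κ := ∑ r, ∑ s, |c r s|
  have hcκ : ∀ r s, c r s ≤ κ := fun r s => by
    calc c r s ≤ |c r s| := le_abs_self _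
      _ ≤ ∑ s, |c r s| := Finset.single_le_sum (f := fun s => |c r s|) (fun _ _ => abs_nonneg _)
        (Finset.mem_univ s)
      _ ≤ κ := Finset.single_le_sum (f := fun r => ∑ s, |c r s|)
        (fun _ _ => Finset.sum_nonneg fun _ _ => abs_nonneg _) (Finset.mem_univ r)
  refine ⟨fun r s => √((κ - c r s) / u), κ, ?_⟩
  have hone : (1 : QOp n) = ∑ r, ∑ s, siteHom i (pairProj r) * siteHom j (pairProj s) := by
    rw [← Fintype.sum_mul_sum, ← map_sum, ← map_sum, sum_pairProj, map_one, map_one, one_mul]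
  have hlhs : ∑ p, ∑ q, α p q • (onQubit i (pauliXZ p) * onQubit j (pauliXZ q))
      = ∑ r, ∑ s, c r s • (siteHom i (pairProj r) * siteHom j (pairProj s) : QOp n) := by
    have h1 : ∀ p q, α p q • (onQubit i (pauliXZ p) * onQubit j (pauliXZ q))
        = ∑ r, ∑ s, (α p q * xzCoeff p r * xzCoeff q s) •
          (siteHom i (pairProj r) * siteHom j (pairProj s) : QOp n) := by
      intro p q
      change α p q • (siteHom i (pauliXZ p) * siteHom j (pauliXZ q)) = _
      rw [pauliXZ_eq_sum, pauliXZ_eq_sum, map_sum, map_sum, Fintype.sum_mul_sum]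
      simp only [siteHom_real_smul, Matrix.smul_mul, Matrix.mul_smul, Finset.smul_sum, smul_smul]
      refine Finset.sum_congr rfl fun r _ => Finset.sum_congr rfl fun s _ => ?_
      congr 1
      ring
    simp only [h1, hc, Fin.sum_univ_two, Finset.sum_add_distrib, add_smul]
  rw [hlhs, hone]
  simp only [Finset.smul_sum, ← Finset.sum_sub_distrib, smul_smul]
  refine Finset.sum_congr rfl fun r _ => Finset.sum_congr rfl fun s _ => ?_
  rw [← sub_smul, Real.sq_sqrt (div_nonneg (sub_nonneg.mpr (hcκ r s)) hu.le)]
  congr 1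
  field_simp
  ring

/-- A one-qubit field in the `X`-`Z` plane, in terms of the interactions within a block. -/
lemma exists_field_weights {n : ℕ} (k : Fin n) (β γ : ℝ) {u : ℝ} (hu : 0 < u) :
    ∃ (d : Fin 3 → ℝ) (κ : ℝ), β • onQubit k pauliX + γ • onQubit k pauliZ
      = ∑ r, (u * d r) • ((2 : ℝ) • siteHom k (pairProj r) - 1) + κ • (1 : QOp n) := by
  refine ⟨![-(3 / 2 * γ) / u, -(√3 / 2 * β) / u, (√3 / 2 * β) / u], -(γ / 2), ?_⟩
  change β • siteHom k pauliX + γ • siteHom k pauliZ = _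
  rw [pauliX_eq_pairProj, pauliZ_eq_pairProj, siteHom_real_smul, map_sub, map_sub, map_one,
    siteHom_real_smul, Fin.sum_univ_three]
  simp only [Matrix.cons_val_zero, Matrix.cons_val_one, Matrix.cons_val, mul_div_cancel₀ _ hu.ne']
  module

lemma exists_weights_of_mem_xzFamily {n : ℕ} {H : QOp n} (hH : H ∈ xzFamily n) {u u' : ℝ}
    (hu : 0 < u) (hu' : 0 < u') :
    ∃ (w : Fin n → Fin n → Fin 3 → Fin 3 → ℝ) (d : Fin n → Fin 3 → ℝ) (c : ℝ),
      H = (∑ k, ∑ r, (u' * d k r) • ((2 : ℝ) • siteHom k (pairProj r) - 1) + c • (1 : QOp n))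
        - u • ∑ i, ∑ j ∈ Finset.Iio i, ∑ r, ∑ q, (w i j r q ^ 2) •
          (siteHom i (pairProj r) * siteHom j (pairProj q)) := by
  obtain ⟨α, β, γ, c, rfl⟩ := hH
  choose w κ hw using fun i j : Fin n => exists_link_weights i j (α i j) hu
  choose d μ hd using fun k : Fin n => exists_field_weights k (β k) (γ k) hu'
  refine ⟨w, d, c + ∑ k, μ k + ∑ i, ∑ j ∈ Finset.Iio i, κ i j, ?_⟩
  simp only [hw, hd, Finset.sum_sub_distrib, Finset.sum_add_distrib, ← Finset.smul_sum,
    ← Finset.sum_smul]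
  module

/-! ### Blocks of physical qubits -/

/-- A basis state of `n * 4` qubits, split into `n` blocks of four. -/
def blockReindex (n : ℕ) : (Fin (n * 4) → Fin 2) ≃ (Fin n → Fin 4 → Fin 2) :=
  (Equiv.arrowCongr finProdFinEquiv.symm (Equiv.refl _)).trans (Equiv.curry _ _ _)

/-- Operators on `n` blocks as operators on `n * 4` qubits. -/
noncomputable def toQubits (n : ℕ) : BlockOp n ≃ₐ[ℝ] QOp (n * 4) :=
  Matrix.reindexAlgEquiv ℝ ℂ (blockReindex n).symm

lemma toQubits_apply {n : ℕ} (A : BlockOp n) :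
    toQubits n A = A.submatrix (blockReindex n) (blockReindex n) := rfl

/-- Qubit `k` of block `j` is the physical qubit `finProdFinEquiv (j, k)`. -/
lemma toQubits_siteHom {n : ℕ} (j : Fin n) (k : Fin 4) (A : Matrix (Fin 2) (Fin 2) ℂ) :
    toQubits n (siteHom j (siteHom k A)) = siteHom (finProdFinEquiv (j, k)) A := by
  ext s t
  simp only [toQubits_apply, Matrix.submatrix_apply, siteHom_apply, onSite, Matrix.of_apply]
  by_cases h : ∀ i, i ≠ finProdFinEquiv (j, k) → s i = t i
  · rw [if_pos h, if_pos, if_pos]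
    · rfl
    · exact fun k' hk => h _ (by simpa using hk)
    · intro j' hj
      funext k'
      exact h _ (by simp [hj])
  · rw [if_neg h]
    split_ifs with h1 h2
    · refine absurd (fun i hi => ?_) h
      obtain ⟨⟨j', k'⟩, rfl⟩ := finProdFinEquiv.surjective i
      by_cases hj : j' = j
      · subst hj
        exact h2 k' fun hk => hi (by rw [hk])
      · exact congrFun (h1 j' hj) k'
    · rfl
    · rfl

/-- The Hamiltonians with interactions from `S`, as a real subspace. -/
noncomputable def interactionSpan {k : ℕ} (S : Set (QOp k)) (m : ℕ) : Submodule ℝ (QOp m) :=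
  Submodule.span ℝ
    ({(1 : QOp m)} ∪ {T | ∃ h ∈ S, ∃ f : Fin k → Fin m, Function.Injective f ∧ T = placed f h})

lemma siteHom_exchange {n : ℕ} (D : Finset (Fin 3)) (j : Fin n) (a b : Fin 4) :
    siteHom j (exchange D a b)
      = ∑ c ∈ D, siteHom j (siteHom a (pauli c)) * siteHom j (siteHom b (pauli c)) := by
  rw [exchange, map_sum]
  simp only [map_mul]

lemma toQubits_exchange {n : ℕ} (D : Finset (Fin 3)) {p q : Fin n × Fin 4} (h : p ≠ q) :
    toQubits n (∑ c ∈ D, siteHom p.1 (siteHom p.2 (pauli c)) * siteHom q.1 (siteHom q.2 (pauli c)))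
      ∈ interactionSpan {exchange D (0 : Fin 2) 1} (n * 4) := by
  rw [map_sum]
  simp only [map_mul, toQubits_siteHom]
  exact
    (exchange_mem_interactionFamily D (finProdFinEquiv.injective.ne h))

section Membership

variable (D : Finset (Fin 3)) {n : ℕ}

lemma toQubits_one_mem :
    toQubits n 1 ∈ interactionSpan {exchange D (0 : Fin 2) 1} (n * 4) := by
  rw [map_one]
  exact Submodule.subset_span (Or.inl rfl)

lemma toQubits_freeHam_mem :
    toQubits n (freeHam D n)
      ∈ interactionSpan {exchange D (0 : Fin 2) 1} (n * 4) := by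
  rw [freeHam, map_sum]
  refine Submodule.sum_mem _ fun j _ => ?_
  have h : blockHam D = ∑ i : Fin 4, ∑ k ∈ Finset.Ioi i, exchange D i k
      + (2 * D.card : ℝ) • (1 : QOp 4) := by
    rw [← sub_eq_iff_eq_add, ← completeGraph4_exchange, completeGraph4_eq_sum]
  rw [h, map_add, siteHom_real_smul, map_one, map_add, map_smul, map_sum, map_sum]
  refine add_mem (Submodule.sum_mem _ fun i _ => ?_)
    (Submodule.smul_mem _ _ (toQubits_one_mem D))
  rw [map_sum, map_sum]
  refine Submodule.sum_mem _ fun k hk => ?_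
  rw [siteHom_exchange]
  exact toQubits_exchange D (p := (j, i)) (q := (j, k))
    (by simpa using (Finset.mem_Ioi.mp hk).ne)

lemma toQubits_fieldHam_mem (d : Fin n → Fin 3 → ℝ) (c : ℝ) :
    toQubits n (fieldHam D d c)
      ∈ interactionSpan {exchange D (0 : Fin 2) 1} (n * 4) := by
  rw [fieldHam, map_add, map_smul, map_sum]
  refine add_mem (Submodule.sum_mem _ fun k _ => ?_)
    (Submodule.smul_mem _ _ (toQubits_one_mem D))
  rw [map_sum]
  refine Submodule.sum_mem _ fun r _ => ?_
  rw [map_smul, siteHom_exchange]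
  exact Submodule.smul_mem _ _ (toQubits_exchange D (p := (k, 0)) (q := (k, r.succ))
    (by simpa using (Fin.succ_ne_zero r).symm))

lemma toQubits_linkHam_mem (w : Fin n → Fin n → Fin 3 → Fin 3 → ℝ) :
    toQubits n (linkHam D w)
      ∈ interactionSpan {exchange D (0 : Fin 2) 1} (n * 4) := by
  have h : ∀ (i j : Fin n) (r q : Fin 3),
      ∑ c ∈ D, siteHom i (staggered c r) * siteHom j (staggered c q)
      = ∑ a, ∑ b, (pairSign r a * pairSign q b) •
        ∑ c ∈ D, siteHom i (siteHom a (pauli c)) * siteHom j (siteHom b (pauli c)) := by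
    intro i j r q
    simp only [staggered, map_sum, siteHom_real_smul, Finset.sum_mul, Finset.mul_sum,
      Matrix.smul_mul, Matrix.mul_smul, smul_smul, Finset.smul_sum]
    rw [Finset.sum_comm, Finset.sum_congr rfl fun b _ => Finset.sum_comm, Finset.sum_comm]
    refine Finset.sum_congr rfl fun a _ => Finset.sum_congr rfl fun b _ =>
      Finset.sum_congr rfl fun c _ => ?_
    rw [mul_comm]
  rw [linkHam, map_sum]
  refine Submodule.sum_mem _ fun i _ => ?_
  rw [map_sum]
  refine Submodule.sum_mem _ fun j hj => ?_
  rw [link, map_sum]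
  refine Submodule.sum_mem _ fun r _ => ?_
  rw [map_sum]
  refine Submodule.sum_mem _ fun q _ => ?_
  rw [map_smul, h, map_sum]
  refine Submodule.smul_mem _ _ (Submodule.sum_mem _ fun a _ => ?_)
  rw [map_sum]
  refine Submodule.sum_mem _ fun b _ => ?_
  rw [map_smul]
  refine Submodule.smul_mem _ _ (toQubits_exchange D (p := (i, a)) (q := (j, b)) fun hp => ?_)
  exact (Finset.mem_Iio.mp hj).ne' (congrArg Prod.fst hp)

end Membership

/-- Forgetting the trivial ancillas of the block encoding. -/
def forgetAncilla (n : ℕ) : (Fin n → Fin 2) × (Fin n → Fin 1) ≃ (Fin n → Fin 2) :=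
  Equiv.prodUnique _ _

lemma kronecker_one_eq_submatrix {n : ℕ} (H : QOp n) :
    H ⊗ₖ (1 : Matrix (Fin n → Fin 1) (Fin n → Fin 1) ℂ)
      = H.submatrix (forgetAncilla n) (forgetAncilla n) := by
  ext x y
  rw [kroneckerMap_apply, Subsingleton.elim x.2 y.2, Matrix.one_apply_eq, mul_one]
  rfl

lemma encode_one_zero {a e b : Type} [Fintype a] [Fintype e] [DecidableEq e]
    (V : Matrix b (a × e) ℂ) (M : Matrix a a ℂ) : encode V 1 0 M =
      V * (M ⊗ₖ (1 : Matrix e e ℂ)) * Vᴴ := by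
  rw [encode, kronecker_zero, add_zero]

/-- Any `X`-`Z` Hamiltonian is simulated by the exchange interactions of blocks of four qubits. -/
theorem exists_simulation {D : Finset (Fin 3)} (h0 : 0 ∈ D) (h1 : 1 ∈ D) {n : ℕ} {H : QOp n}
    (hH : H ∈ xzFamily n) : ∃ Δ₀ : ℝ, 0 < Δ₀ ∧ ∀ Δ η ε : ℝ, Δ₀ ≤ Δ → 0 < η → 0 < ε →
      ∃ H' : QOp (n * 4), H' ∈ interactionFamily {exchange D (0 : Fin 2) 1} (n * 4) ∧
        SimulatesVia (blockEncoding singletIso singletIso_isometry n) H' H Δ η ε := by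
  have hcard : 2 ≤ D.card := by
    calc 2 = ({0, 1} : Finset (Fin 3)).card := by decide
      _ ≤ D.card := Finset.card_le_card (by simp [Finset.insert_subset_iff, h0, h1])
  have hcard' : (2 : ℝ) ≤ D.card := by exact_mod_cast hcard
  -- the energy of two excited blocks
  set e : ℝ := 2 * (2 * (D.card - 1)) with he
  have he0 : 0 < e := by rw [he]; linarith
  obtain ⟨w, d, c, hw⟩ := exists_weights_of_mem_xzFamily hH
    (u := e⁻¹ * (256 * D.card)) (u' := D.card) (by positivity) (by positivity)
  set f := forgetAncilla n
  set b := blockReindex n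
  set Hf : Matrix ((Fin n → Fin 2) × (Fin n → Fin 1)) ((Fin n → Fin 2) × (Fin n → Fin 1)) ℂ :=
    H ⊗ₖ 1 with hHf
  set V : Matrix (Fin (n * 4) → Fin 2) ((Fin n → Fin 2) × (Fin n → Fin 1)) ℂ :=
    (blockIso n).submatrix b f with hV
  refine ⟨‖Hf‖ + 1, by positivity, fun Δ η ε hΔ hη hε => ?_⟩
  have hherm : ∀ {A : BlockOp n}, A.IsHermitian → (toQubits n A).IsHermitian := fun h =>
    h.submatrix _
  obtain ⟨t, ht, V', hV', hP, hn, hm⟩ := exists_perturbation (H₀ := toQubits n (freeHam D n))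
    (H₁ := toQubits n (fieldHam D d c)) (H₂ := toQubits n (linkHam D w)) (H := Hf) (V := V) (e := e)
    (hherm (freeHam_isHermitian D)) (hherm (fieldHam_isHermitian D d c))
    (hherm (linkHam_isHermitian D w))
    (by
      rw [hV, conjTranspose_submatrix, Matrix.submatrix_mul_equiv, blockIso_isometry,
        Matrix.submatrix_one_equiv])
    (by
      rw [hV, toQubits_apply, Matrix.submatrix_mul_equiv, freeHam_mul_blockIso]
      rfl)
    (by
      rw [hV, toQubits_apply, conjTranspose_submatrix, Matrix.submatrix_mul_equiv]
      exact (posDef_freeHam_add D h0 h1).submatrix b.injective)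
    he0.ne'
    (by
      rw [hV, toQubits_apply, toQubits_apply, Matrix.submatrix_mul_equiv,
        Matrix.submatrix_mul_equiv, freeHam_mul_linkHam]
      ext x y
      simp only [Matrix.submatrix_apply, Matrix.smul_apply, Complex.real_smul, smul_eq_mul, he])
    (by
      rw [hV, toQubits_apply, toQubits_apply, conjTranspose_submatrix]
      rw [Matrix.submatrix_mul_equiv, Matrix.submatrix_mul_equiv, Matrix.submatrix_mul_equiv,
        Matrix.submatrix_mul_equiv, Matrix.submatrix_mul_equiv, compression_fieldHam,
        compression_linkHam_linkHam, hHf, kronecker_one_eq_submatrix, hw]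
      ext x y
      simp only [Matrix.sub_apply, Matrix.submatrix_apply, Matrix.smul_apply, Complex.real_smul,
        smul_eq_mul]
      push_cast
      ring)
    hΔ hη hε
  refine ⟨(t ^ 2)⁻¹ • toQubits n (freeHam D n) + t⁻¹ • toQubits n (linkHam D w)
    + toQubits n (fieldHam D d c), ?_, V', hV', ?_, hn, ?_⟩
  · exact add_mem (add_mem (Submodule.smul_mem _ _ (toQubits_freeHam_mem D))
      (Submodule.smul_mem _ _ (toQubits_linkHam_mem D w))) (toQubits_fieldHam_mem D d c)
  · have hE : encode V' (1 : Matrix (Fin n → Fin 1) (Fin n → Fin 1) ℂ) 0 (1 : QOp n)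
        = lowEnergyProj ((t ^ 2)⁻¹ • toQubits n (freeHam D n) + t⁻¹ • toQubits n (linkHam D w)
          + toQubits n (fieldHam D d c)) Δ := by
      rw [encode_one_zero, one_kronecker_one, Matrix.mul_one, hP]
    exact hE
  · rw [hHf, ← encode_one_zero] at hm
    exact hm

end QubitSim

theorem mainTheorem3 :
    (CanSimulate (interactionFamily {heisenberg}) xzFamily ∧
      CanSimulate (interactionFamily {xyInteraction}) xzFamily) ∧
    ∀ h ∈ ({heisenberg, xyInteraction} : Set (QOp 2)),
      Module.finrank ℂ (groundSpace (completeGraph4 h)) = 2 ∧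
      ∃ (W : Matrix (Fin 4 → Fin 2) (Fin 2) ℂ) (hW : W.conjTranspose * W = 1),
        LinearMap.range (Matrix.toEuclideanLin W) = groundSpace (completeGraph4 h) ∧
        ∀ (n : ℕ) (H : QOp n), H ∈ xzFamily n → ∃ Δ₀ : ℝ, 0 < Δ₀ ∧
          ∀ Δ η ε : ℝ, Δ₀ ≤ Δ → 0 < η → 0 < ε →
            ∃ H' : QOp (n * 4), H' ∈ interactionFamily {h} (n * 4) ∧
              SimulatesVia (blockEncoding W hW n) H' H Δ η ε := by
  have can : ∀ D : Finset (Fin 3), 0 ∈ D → 1 ∈ D →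
      CanSimulate (interactionFamily {exchange D (0 : Fin 2) 1}) xzFamily := by
    intro D h0 h1 n H hH
    obtain ⟨Δ₀, hΔ₀, h⟩ := exists_simulation h0 h1 hH
    refine ⟨Δ₀, hΔ₀, fun Δ η ε hΔ hη hε => ?_⟩
    obtain ⟨H', hH', hs⟩ := h Δ η ε hΔ hη hε
    exact ⟨n * 4, H', hH', _, hs⟩
  have block : ∀ D : Finset (Fin 3), 0 ∈ D → 1 ∈ D →
      Module.finrank ℂ (groundSpace (completeGraph4 (exchange D (0 : Fin 2) 1))) = 2 ∧
      ∃ (W : Matrix (Fin 4 → Fin 2) (Fin 2) ℂ) (hW : W.conjTranspose * W = 1),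
        LinearMap.range (Matrix.toEuclideanLin W)
          = groundSpace (completeGraph4 (exchange D (0 : Fin 2) 1)) ∧
        ∀ (n : ℕ) (H : QOp n), H ∈ xzFamily n → ∃ Δ₀ : ℝ, 0 < Δ₀ ∧
          ∀ Δ η ε : ℝ, Δ₀ ≤ Δ → 0 < η → 0 < ε →
            ∃ H' : QOp (n * 4), H' ∈ interactionFamily {exchange D (0 : Fin 2) 1} (n * 4) ∧
              SimulatesVia (blockEncoding W hW n) H' H Δ η ε := by
    intro D h0 h1
    rw [groundSpace_completeGraph4 h0 h1]
    exact ⟨finrank_range_singletIso, singletIso, singletIso_isometry, rfl,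
      fun n H hH => exists_simulation h0 h1 hH⟩
  refine ⟨⟨?_, ?_⟩, ?_⟩
  · rw [heisenberg_eq_exchange]
    exact can _ (by simp) (by simp)
  · rw [xyInteraction_eq_exchange]
    exact can _ (by simp) (by simp)
  · rintro h (rfl | rfl)
    · rw [heisenberg_eq_exchange]
      exact block _ (by simp) (by simp)
    · rw [xyInteraction_eq_exchange]
      exact block _ (by simp) (by simp)
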